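/- Let $H$ be a complex Hilbert space with a fixed orthonormal basis $(e_i)_{i\in I}$ ($I$ of any cardinality), and let $Jx=\sum_i\overline{\langle e_i,x\rangle}\,e_i$ be the complex conjugation in this basis. For $A\in B(H)$ put $A^{T}=JA^*J$ and $\overline A=JAJ$. A linear map $\varphi$ on $B(H)$ is called *decomposable* if $\varphi=\varphi_1+\varphi_2$ with $\varphi_1$ completely positive and $A\mapsto\varphi_2(A)^{T}$ completely positive, and *normal* if it is weak-\* continuous. Let $G$ be a compact topological group (for instance a compact Lie group), and let $U$ be a strongly continuous unitary representation of $G$ on $H$. Let $G$ act on $B(H)$ by $*$-automorphisms of the form $g(A)=V(g)AV(g)^{-1}$, where each $V(g)$ is a unitary operator on $H$, and where $g\mapsto\langle x,g(A)y\rangle$ is continuous for all $A\in B(H)$ and $x,y\in H$. A linear map $\varphi$ on $B(H)$ is *$U$-covariant* if $\varphi(g(A))=U(g)\varphi(A)U(g)^{-1}$ for all $g\in G$, $A\in B(H)$. **Theorem.** A normal decomposable map $\varphi$ on $B(H)$ is $U$-covariant if and only if there exist families $(X_n)$, $(W_n)$ in $B(H)$ such that $\sum_nX_nX_n^*$ and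 $\sum_nW_nW_n^*$ converge in the weak-\* topology, $$\varphi(A)=\sum_nX_nAX_n^*+\sum_n\overline{W_n}\,A^{T}\,\overline{W_n}^{\,*}\qquad(A\in B(H))$$ with weak-\* convergent sums (the second sum equals $\big(\sum_nW_nAW_n^*\big)^{T}$), and for every $g\in G$ there are unitary matrices $[N_{nm}]$, $[M_{nm}]$ (possibly infinite, depending on $g$) with $$U(g)X_nV(g)^{-1}=\sum_mN_{nm}X_m,\qquad \overline{U(g)}\,W_nV(g)^{-1}=\sum_mM_{nm}W_m$$ for all $n$, with weak-\* convergent sums. If $H$ is separable, the same equivalence also holds with the families required to be countable. -/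

import Mathlib

open scoped CStarAlgebra InnerProductSpace

universe u

noncomputable section

namespace CovDec

variable {H : Type*} [NormedAddCommGroup H] [InnerProductSpace ℂ H]

/-! ### Complex conjugation and transposition with respect to a Hilbert basis -/

section Transposition

variable {I : Type*} (b : HilbertBasis I ℂ H)

/-- The antilinear map `J` of complex conjugation of vectors in the orthonormal basis `b`,
`J x = ∑ i, conj ⟪b i, x⟫ • b i` (see `hasSum_J`). -/
def J : H →L⋆[ℂ] H :=
  LinearMap.mkContinuous
    { toFun := fun x => b.repr.symm (star (b.repr x))
      map_add' := fun x y => by simp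
      map_smul' := fun c x => by simp }
    1 (fun x => by simp)

theorem J_apply (x : H) : J b x = b.repr.symm (star (b.repr x)) := rfl

theorem hasSum_J (x : H) :
    HasSum (fun i => (starRingEnd ℂ) ⟪b i, x⟫_ℂ • b i) (J b x) := by
  have h := b.hasSum_repr_symm (star (b.repr x))
  simpa [J_apply, b.repr_apply_apply] using h

theorem J_J (x : H) : J b (J b x) = x := by
  simp [J_apply]

variable [CompleteSpace H]

/-- The transpose `Aᵀ = J A* J`, as a linear map on `B(H)`. -/
def transpose : (H →L[ℂ] H) →ₗ[ℂ] (H →L[ℂ] H) where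
  toFun A := (J b).comp ((star A).comp (J b))
  map_add' A B := by ext x; simp
  map_smul' c A := by ext x; simp

theorem transpose_apply (A : H →L[ℂ] H) (x : H) :
    transpose b A x = J b ((star A) (J b x)) := rfl

/-- The conjugate `Ā = (A*)ᵀ = J A J` of an operator. -/
def conjOp (A : H →L[ℂ] H) : H →L[ℂ] H := transpose b (star A)

theorem conjOp_apply (A : H →L[ℂ] H) (x : H) : conjOp b A x = J b (A (J b x)) := by
  simp [conjOp, transpose_apply]

end Transposition

variable [CompleteSpace H]

/-! ### Complete positivity and decomposability -/

/-- `φ` is completely positive: all amplifications to matrix algebras are positive. -/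
def IsCP (φ : (H →L[ℂ] H) →ₗ[ℂ] (H →L[ℂ] H)) : Prop :=
  ∃ ψ : (H →L[ℂ] H) →CP (H →L[ℂ] H), ψ.toLinearMap = φ

/-- `φ` is completely copositive: transposition after `φ` is completely positive. -/
def IsCoCP {I : Type*} (b : HilbertBasis I ℂ H) (φ : (H →L[ℂ] H) →ₗ[ℂ] (H →L[ℂ] H)) : Prop :=
  IsCP (transpose b ∘ₗ φ)

/-- `φ` is decomposable: a sum of a completely positive and a completely copositive map. -/
def IsDecomposable {I : Type*} (b : HilbertBasis I ℂ H)
    (φ : (H →L[ℂ] H) →ₗ[ℂ] (H →L[ℂ] H)) : Prop :=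
  ∃ φ₁ φ₂ : (H →L[ℂ] H) →ₗ[ℂ] (H →L[ℂ] H), IsCP φ₁ ∧ IsCoCP b φ₂ ∧ φ = φ₁ + φ₂

/-! ### The weak-* topology of `B(H)` -/

variable (H) in
/-- The weak-* (σ-weak) topology of `B(H)`: the coarsest topology for which all normal
functionals are continuous. These are exactly the functionals `A ↦ tr (T A)` with `T` of trace
class, that is `A ↦ ∑ i, ⟪x i, A (y i)⟫` with square-summable sequences `x`, `y` in `H`. -/
abbrev weakStarTopology : TopologicalSpace (H →L[ℂ] H) :=
  ⨅ (x : lp (fun _ : ℕ => H) 2) (y : lp (fun _ : ℕ => H) 2),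
    TopologicalSpace.induced (fun A : H →L[ℂ] H => ∑' i, ⟪x i, A (y i)⟫_ℂ) inferInstance

/-- The family `f` of operators is summable in the weak-* topology with sum `S`. -/
def HasWeakStarSum {ι : Type*} (f : ι → (H →L[ℂ] H)) (S : H →L[ℂ] H) : Prop :=
  Filter.Tendsto (fun s : Finset ι => ∑ n ∈ s, f n) Filter.atTop (@nhds _ (weakStarTopology H) S)

/-- `φ` is normal: it is continuous for the weak-* topology of `B(H)`. -/
def IsNormal (φ : (H →L[ℂ] H) →ₗ[ℂ] (H →L[ℂ] H)) : Prop :=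
  @Continuous _ _ (weakStarTopology H) (weakStarTopology H) φ

/-! ### Covariance -/

/-- A possibly infinite matrix is unitary: its rows and its columns are orthonormal in `ℓ²`. -/
structure IsUnitaryMatrix {ι : Type*} [DecidableEq ι] (N : Matrix ι ι ℂ) : Prop where
  rows : ∀ n k, HasSum (fun m => N n m * star (N k m)) (if n = k then 1 else 0)
  cols : ∀ n k, HasSum (fun m => star (N m n) * N m k) (if n = k then 1 else 0)

/-- `φ (g(A)) = U(g) φ(A) U(g)⁻¹` for the action `α` of `G` on `B(H)`. -/
def IsCovariant {G : Type*} [Group G] (α : G →* ((H →L[ℂ] H) ≃⋆ₐ[ℂ] (H →L[ℂ] H)))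
    (U : G →* unitary (H →L[ℂ] H)) (φ : (H →L[ℂ] H) →ₗ[ℂ] (H →L[ℂ] H)) : Prop :=
  ∀ (g : G) (A : H →L[ℂ] H), φ (α g A) = (U g : H →L[ℂ] H) * φ A * ((U g)⁻¹ : unitary _)

open scoped Classical in
/-- The families `X` and `W` form a Kraus representation of `φ`, in which both families are
transformed by unitary matrices under the group. The coCP part of `φ` is the transpose of
`A ↦ ∑ n, W n * A * (W n)*`, that is `A ↦ ∑ n, W̄ n * Aᵀ * (W̄ n)*`. -/
structure IsCovariantKraus {G : Type*} [Group G] {I : Type*} (b : HilbertBasis I ℂ H)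
    (U : G →* unitary (H →L[ℂ] H)) (V : G → unitary (H →L[ℂ] H))
    (φ : (H →L[ℂ] H) →ₗ[ℂ] (H →L[ℂ] H))
    {ι κ : Type*} (X : ι → (H →L[ℂ] H)) (W : κ → (H →L[ℂ] H)) : Prop where
  summable_X : ∃ S, HasWeakStarSum (fun n => X n * star (X n)) S
  summable_W : ∃ S, HasWeakStarSum (fun n => W n * star (W n)) S
  kraus : ∀ A, ∃ P Q,
    HasWeakStarSum (fun n => X n * A * star (X n)) P ∧
    HasWeakStarSum (fun n => conjOp b (W n) * transpose b A * star (conjOp b (W n))) Q ∧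
    φ A = P + Q
  transform_X : ∀ g, ∃ N : Matrix ι ι ℂ, IsUnitaryMatrix N ∧
    ∀ n, HasWeakStarSum (fun m => N n m • X m)
      ((U g : H →L[ℂ] H) * X n * ((V g)⁻¹ : unitary _))
  transform_W : ∀ g, ∃ M : Matrix κ κ ℂ, IsUnitaryMatrix M ∧
    ∀ n, HasWeakStarSum (fun m => M n m • W m)
      (conjOp b (U g : H →L[ℂ] H) * W n * ((V g)⁻¹ : unitary _))

end CovDec

end

noncomputable section

namespace CovDec

open Filter Topology

variable {H : Type*} [NormedAddCommGroup H] [InnerProductSpace ℂ H]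

/-! ### The conjugation -/

section Conjugation

variable {I : Type*} (b : HilbertBasis I ℂ H)

/-! The substance is the passage from covariance to covariant Kraus families. The summands of `φ =
φ₁ + φ₂` need be neither covariant nor normal. Averaging `φ₁` over `G` with `U`, and the transpose
of `φ₂` with the conjugate representation, makes both covariant; since `φ` is covariant, the
averages still add up to `φ`. The averages are formed only on finite-rank operators. Orbits of
rank-one operators are norm continuous (`continuous_action_rankOne`), although `V` itself need be
neither continuous nor multiplicative. Finite rank is enough because `φ` is normal: finite-rank
operators are weak-* dense, so Kraus sums that agree with `φ` there agree with it everywhere.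

On the rank-one operators `|x⟩⟨y|` each average is a positive semidefinite operator-valued kernel `K
x y` (`exists_averaged_kernel`). Its reproducing kernel Hilbert space consists of bounded operators
on `H`, and an orthonormal basis of that space is a Kraus family (`exists_kraus_of_kernel`).
Covariance of `K` says that `f ↦ U(g) f V(g)⁻¹` is unitary on this space; its matrix in the basis is
the required one.

Conversely, a Kraus sum tested on vectors, `∑ ⟪Xₙ* h, A Xₙ* k⟫`, is an inner product in `ℓ²(ι, H)`,
and a unitary matrix acts there isometrically (`IsUnitaryMatrix.hasSum_inner`).

In the separable case the basis is countable, because its members are nonzero and `∑ ‖Xₙ* h‖²` is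
finite for every `h` (`RowBounded.countable`). -/

theorem inner_J_left (x y : H) : ⟪J b x, y⟫_ℂ = ⟪J b y, x⟫_ℂ := by
  -- The inner product becomes the bilinear form `∑ xᵢ yᵢ` in coordinates, which is visibly
  -- symmetric.
  have h : ∀ x y : H, ⟪J b x, y⟫_ℂ = ∑' i, b.repr x i * b.repr y i := by
    intro x y
    rw [J_apply, ← b.repr.inner_map_map, LinearIsometryEquiv.apply_symm_apply, lp.inner_eq_tsum]
    simp [mul_comm]
  rw [h, h]
  simp only [mul_comm]

theorem inner_J_right (x y : H) : ⟪x, J b y⟫_ℂ = ⟪y, J b x⟫_ℂ := by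
  rw [← inner_conj_symm, inner_J_left, inner_conj_symm]

theorem norm_J (x : H) : ‖J b x‖ = ‖x‖ := by
  simp [J_apply]

variable [CompleteSpace H]

theorem inner_transpose (A : H →L[ℂ] H) (x y : H) :
    ⟪x, transpose b A y⟫_ℂ = ⟪J b y, A (J b x)⟫_ℂ := by
  rw [transpose_apply, inner_J_right, ContinuousLinearMap.star_eq_adjoint,
    ContinuousLinearMap.adjoint_inner_left]

theorem transpose_transpose (A : H →L[ℂ] H) : transpose b (transpose b A) = A := by
  ext x
  refine ext_inner_left ℂ fun y => ?_
  rw [inner_transpose, inner_transpose, J_J, J_J]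

theorem star_conjOp (A : H →L[ℂ] H) : star (conjOp b A) = conjOp b (star A) := by
  ext x
  refine ext_inner_left ℂ fun y => ?_
  rw [ContinuousLinearMap.star_eq_adjoint, ContinuousLinearMap.adjoint_inner_right, conjOp_apply,
    conjOp_apply, inner_J_left, inner_J_right, ContinuousLinearMap.star_eq_adjoint,
    ContinuousLinearMap.adjoint_inner_left]

theorem conjOp_one : conjOp b (1 : H →L[ℂ] H) = 1 := by
  ext x
  simp [conjOp_apply, J_J]

theorem conjOp_mul (A B : H →L[ℂ] H) : conjOp b (A * B) = conjOp b A * conjOp b B := by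
  ext x
  simp [conjOp_apply, J_J]

/-- The conjugate of a unitary representation. -/
def conjRep {G : Type*} [Group G] (U : G →* unitary (H →L[ℂ] H)) : G →* unitary (H →L[ℂ] H) where
  toFun g := ⟨conjOp b (U g), by
    rw [Unitary.mem_iff, star_conjOp, ← conjOp_mul, ← conjOp_mul]
    simp [conjOp_one]⟩
  map_one' := Subtype.ext (by simp [conjOp_one])
  map_mul' g h := Subtype.ext (by simp [conjOp_mul])

theorem conjRep_coe {G : Type*} [Group G] (U : G →* unitary (H →L[ℂ] H)) (g : G) :
    ((conjRep b U g : unitary _) : H →L[ℂ] H) = conjOp b (U g) := rfl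

theorem conjRep_apply {G : Type*} [Group G] (U : G →* unitary (H →L[ℂ] H)) (g : G) (x : H) :
    (conjRep b U g : H →L[ℂ] H) x = J b ((U g : H →L[ℂ] H) (J b x)) := by
  rw [conjRep_coe, conjOp_apply]

theorem continuous_conjRep {G : Type*} [Group G] [TopologicalSpace G]
    (U : G →* unitary (H →L[ℂ] H)) (hU : ∀ x : H, Continuous fun g => (U g : H →L[ℂ] H) x) (x : H) :
    Continuous fun g => (conjRep b U g : H →L[ℂ] H) x := by
  simp only [conjRep_apply]
  exact (J b).continuous.comp (hU _)

end Conjugation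

/-! ### Weak-* convergence -/

theorem tendsto_weakStar_iff {α : Type*} {l : Filter α} {f : α → (H →L[ℂ] H)} {S : H →L[ℂ] H} :
    Tendsto f l (@nhds _ (weakStarTopology H) S) ↔
      ∀ x y : lp (fun _ : ℕ => H) 2,
        Tendsto (fun a => ∑' i, ⟪x i, f a (y i)⟫_ℂ) l (𝓝 (∑' i, ⟪x i, S (y i)⟫_ℂ)) := by
  simp only [nhds_iInf, nhds_induced, tendsto_iInf, tendsto_comap_iff]
  rfl

theorem tsum_inner_single (A : H →L[ℂ] H) (h k : H) :
    ∑' i, ⟪(lp.single 2 0 h : lp (fun _ : ℕ => H) 2) i,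
      A ((lp.single 2 0 k : lp (fun _ : ℕ => H) 2) i)⟫_ℂ = ⟪h, A k⟫_ℂ := by
  rw [tsum_eq_single 0]
  · simp
  · intro i hi
    simp [hi]

theorem tendsto_inner_of_weakStar {α : Type*} {l : Filter α} {f : α → (H →L[ℂ] H)}
    {S : H →L[ℂ] H} (hf : Tendsto f l (@nhds _ (weakStarTopology H) S)) (h k : H) :
    Tendsto (fun a => ⟪h, f a k⟫_ℂ) l (𝓝 ⟪h, S k⟫_ℂ) := by
  simpa only [tsum_inner_single] using
    tendsto_weakStar_iff.1 hf (lp.single 2 0 h) (lp.single 2 0 k)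

theorem HasWeakStarSum.hasSum_inner {ι : Type*} {f : ι → (H →L[ℂ] H)} {S : H →L[ℂ] H}
    (hf : HasWeakStarSum f S) (h k : H) : HasSum (fun n => ⟪h, f n k⟫_ℂ) ⟪h, S k⟫_ℂ := by
  have := tendsto_inner_of_weakStar hf h k
  simpa [HasSum, sum_apply, inner_sum] using this

theorem summable_lp_sq {ι E : Type*} [NormedAddCommGroup E] (x : lp (fun _ : ι => E) 2) :
    Summable fun i => ‖x i‖ ^ 2 := by
  simpa using (lp.memℓp x).summable (by simp)

/-- Fubini: absolute summability over pairs allows the sum over `n` and the sum in the weak-*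
functional to be exchanged, so convergence on single pairs of vectors suffices. -/
theorem hasWeakStarSum_of_summable {ι : Type*} {f : ι → (H →L[ℂ] H)} {S : H →L[ℂ] H}
    (hs : ∀ x y : lp (fun _ : ℕ => H) 2,
      Summable fun p : ℕ × ι => ⟪x p.1, f p.2 (y p.1)⟫_ℂ)
    (hf : ∀ h k, HasSum (fun n => ⟪h, f n k⟫_ℂ) ⟪h, S k⟫_ℂ) : HasWeakStarSum f S := by
  refine tendsto_weakStar_iff.2 fun x y => ?_
  have h1 : HasSum (fun n => ∑' i, ⟪x i, f n (y i)⟫_ℂ)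
      (∑' p : ℕ × ι, ⟪x p.1, f p.2 (y p.1)⟫_ℂ) := by
    have h2 := (hs x y).prod_symm
    have h3 := h2.hasSum.prod_fiberwise fun n => (h2.prod_factor n).hasSum
    rwa [← (Equiv.prodComm ι ℕ).tsum_eq (fun p : ℕ × ι => ⟪x p.1, f p.2 (y p.1)⟫_ℂ)]
  have h2 : ∑' i, ⟪x i, S (y i)⟫_ℂ = ∑' p : ℕ × ι, ⟪x p.1, f p.2 (y p.1)⟫_ℂ :=
    ((hs x y).hasSum.prod_fiberwise fun i => hf (x i) (y i)).tsum_eq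
  rw [h2]
  refine Tendsto.congr (fun s => ?_) h1
  have h3 : ∀ n ∈ s, Summable fun i => ⟪x i, f n (y i)⟫_ℂ :=
    fun n _ => (hs x y).prod_symm.prod_factor n
  refine (Summable.tsum_finsetSum h3).symm.trans (tsum_congr fun i => ?_)
  simp [sum_apply]

theorem norm_inner_le_add_sq (x y : H) : ‖⟪x, y⟫_ℂ‖ ≤ ‖x‖ ^ 2 + ‖y‖ ^ 2 := by
  have := norm_inner_le_norm (𝕜 := ℂ) x y
  nlinarith [sq_nonneg (‖x‖ - ‖y‖), sq_nonneg ‖x‖, sq_nonneg ‖y‖]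

/-! ### Row-bounded families -/

variable [CompleteSpace H]

/-- The partial sums of `∑ n, X n * (X n)*` are bounded. -/
def RowBounded {ι : Type*} (X : ι → (H →L[ℂ] H)) : Prop :=
  ∃ C : ℝ, ∀ (h : H) (s : Finset ι), ∑ n ∈ s, ‖star (X n) h‖ ^ 2 ≤ C * ‖h‖ ^ 2

theorem RowBounded.summable {ι : Type*} {X : ι → (H →L[ℂ] H)} (hX : RowBounded X) (h : H) :
    Summable fun n => ‖star (X n) h‖ ^ 2 := by
  obtain ⟨C, hC⟩ := hX
  exact summable_of_sum_le (fun _ => by positivity) (hC h)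

theorem RowBounded.summable_prod {ι : Type*} {X : ι → (H →L[ℂ] H)} (hX : RowBounded X)
    (x : lp (fun _ : ℕ => H) 2) : Summable fun p : ℕ × ι => ‖star (X p.2) (x p.1)‖ ^ 2 := by
  have hX' := hX.summable
  obtain ⟨C, hC⟩ := hX
  have h1 : ∀ i, ∑' n, ‖star (X n) (x i)‖ ^ 2 ≤ C * ‖x i‖ ^ 2 :=
    fun i => (hX' (x i)).tsum_le_of_sum_le (hC (x i))
  have h2 : ∀ i, 0 ≤ ∑' n, ‖star (X n) (x i)‖ ^ 2 := fun i => tsum_nonneg fun n => sq_nonneg _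
  have h3 : Summable fun i => ∑' n, ‖star (X n) (x i)‖ ^ 2 :=
    Summable.of_nonneg_of_le h2 h1 ((summable_lp_sq x).mul_left C)
  exact (summable_prod_of_nonneg fun p => sq_nonneg ‖star (X p.2) (x p.1)‖).2
    ⟨fun i => hX' (x i), h3⟩

theorem RowBounded.mul_right {ι : Type*} {X : ι → (H →L[ℂ] H)} (hX : RowBounded X)
    (A : H →L[ℂ] H) : RowBounded fun n => X n * A := by
  obtain ⟨C, hC⟩ := hX
  refine ⟨‖star A‖ ^ 2 * C, fun h s => ?_⟩
  calc ∑ n ∈ s, ‖star (X n * A) h‖ ^ 2 ≤ ∑ n ∈ s, ‖star A‖ ^ 2 * ‖star (X n) h‖ ^ 2 := by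
        refine Finset.sum_le_sum fun n _ => ?_
        rw [star_mul, ← mul_pow]
        exact pow_le_pow_left₀ (norm_nonneg _) ((star A).le_opNorm _) 2
    _ ≤ ‖star A‖ ^ 2 * C * ‖h‖ ^ 2 := by
        rw [← Finset.mul_sum, mul_assoc]
        exact mul_le_mul_of_nonneg_left (hC h s) (by positivity)

theorem RowBounded.conjOp {ι I : Type*} (b : HilbertBasis I ℂ H) {X : ι → (H →L[ℂ] H)}
    (hX : RowBounded X) : RowBounded fun n => conjOp b (X n) := by
  obtain ⟨C, hC⟩ := hX
  refine ⟨C, fun h s => ?_⟩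
  simpa only [star_conjOp, conjOp_apply, norm_J] using hC (J b h) s

/-- The operator `h ↦ (X n)* h` into the Hilbert sum. -/
theorem RowBounded.exists_column {ι : Type*} {X : ι → (H →L[ℂ] H)} (hX : RowBounded X) :
    ∃ T : H →L[ℂ] lp (fun _ : ι => H) 2, ∀ h n, T h n = star (X n) h := by
  have hmem : ∀ h, Memℓp (fun n => star (X n) h) 2 := fun h =>
    memℓp_gen (by simpa using hX.summable h)
  obtain ⟨C, hC⟩ := hX
  refine ⟨LinearMap.mkContinuous
    { toFun := fun h => ⟨fun n => star (X n) h, hmem h⟩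
      map_add' := fun h k => Subtype.ext (funext fun n => map_add (star (X n)) h k)
      map_smul' := fun c h => Subtype.ext (funext fun n => map_smul (star (X n)) c h) }
    -- `RowBounded` does not force `C` to be nonnegative.
    (√(max C 0)) fun h => ?_, fun h n => rfl⟩
  refine lp.norm_le_of_forall_sum_le (by simp) (by positivity) fun s => ?_
  simp only [ENNReal.toReal_ofNat, Real.rpow_ofNat]
  rw [mul_pow, Real.sq_sqrt (le_max_right _ _)]
  exact (hC h s).trans (mul_le_mul_of_nonneg_right (le_max_left _ _) (by positivity))

theorem inner_mul_mul_star (X A : H →L[ℂ] H) (h k : H) :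
    ⟪h, (X * A * star X) k⟫_ℂ = ⟪star X h, A (star X k)⟫_ℂ := by
  simp [ContinuousLinearMap.star_eq_adjoint, ContinuousLinearMap.adjoint_inner_left]

/-- The Kraus sum of a row-bounded family converges. -/
theorem RowBounded.exists_hasWeakStarSum {ι : Type*} {X : ι → (H →L[ℂ] H)} (hX : RowBounded X)
    (A : H →L[ℂ] H) : ∃ S, HasWeakStarSum (fun n => X n * A * star (X n)) S := by
  -- As `(Xₙ A*)* = A Xₙ*`, the second column operator is `T' k = (A Xₙ* k)ₙ`, and the Kraus sum is
  -- `T* T'`.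
  have hXA := hX.mul_right (star A)
  obtain ⟨T, hT⟩ := hX.exists_column
  obtain ⟨T', hT'⟩ := hXA.exists_column
  refine ⟨T.adjoint ∘L T', hasWeakStarSum_of_summable (fun x y => ?_) fun h k => ?_⟩
  · refine Summable.of_norm_bounded ((hX.summable_prod x).add (hXA.summable_prod y)) fun p => ?_
    rw [inner_mul_mul_star]
    simpa using norm_inner_le_add_sq (star (X p.2) (x p.1)) (A (star (X p.2) (y p.1)))
  · have := lp.hasSum_inner (𝕜 := ℂ) (T h) (T' k)
    rw [ContinuousLinearMap.comp_apply, ContinuousLinearMap.adjoint_inner_right]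
    refine this.congr_fun ?_
    intro n
    rw [hT, hT', inner_mul_mul_star]
    simp

/-- The terms are dominated by `‖Xₙ* xᵢ‖² + |cₙ|² ‖yᵢ‖²`, summable over pairs by row-boundedness and
square-summability of `c`. -/
theorem RowBounded.hasWeakStarSum_smul {ι : Type*} {X : ι → (H →L[ℂ] H)} (hX : RowBounded X)
    {c : ι → ℂ} (hc : Summable fun n => ‖c n‖ ^ 2) {S : H →L[ℂ] H}
    (hS : ∀ h k, HasSum (fun n => c n * ⟪h, X n k⟫_ℂ) ⟪h, S k⟫_ℂ) :
    HasWeakStarSum (fun n => c n • X n) S := by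
  refine hasWeakStarSum_of_summable (fun x y => ?_) fun h k => by
    simpa [inner_smul_right] using hS h k
  have h1 : Summable fun p : ℕ × ι => ‖y p.1‖ ^ 2 * ‖c p.2‖ ^ 2 :=
    (summable_lp_sq y).mul_of_nonneg hc (fun _ => by positivity) fun _ => by positivity
  refine Summable.of_norm_bounded ((hX.summable_prod x).add h1) fun p => ?_
  have h2 : ⟪x p.1, (c p.2 • X p.2) (y p.1)⟫_ℂ = ⟪star (X p.2) (x p.1), c p.2 • y p.1⟫_ℂ := by
    rw [ContinuousLinearMap.star_eq_adjoint, ContinuousLinearMap.adjoint_inner_left,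
      map_smul]
    rfl
  rw [h2]
  refine (norm_inner_le_add_sq _ _).trans_eq ?_
  rw [norm_smul, mul_pow, mul_comm (‖c p.2‖ ^ 2)]

end CovDec

namespace CovDec

open Filter Topology

variable {H : Type*} [NormedAddCommGroup H] [InnerProductSpace ℂ H]

theorem opMul_apply (A B : H →L[ℂ] H) (x : H) : (A * B) x = A (B x) := rfl

theorem coe_inv_unitary [CompleteSpace H] (u : unitary (H →L[ℂ] H)) :
    ((u⁻¹ : unitary (H →L[ℂ] H)) : H →L[ℂ] H) = star (u : H →L[ℂ] H) := rfl

theorem inner_star_left [CompleteSpace H] (B : H →L[ℂ] H) (x y : H) :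
    ⟪star B x, y⟫_ℂ = ⟪x, B y⟫_ℂ := by
  rw [ContinuousLinearMap.star_eq_adjoint, ContinuousLinearMap.adjoint_inner_left]

/-! ### Covariant Kraus families give covariant maps -/

section UnitaryMatrix

variable {ι : Type*} [DecidableEq ι]

theorem IsUnitaryMatrix.summable_row {N : Matrix ι ι ℂ} (hN : IsUnitaryMatrix N) (n : ι) :
    Summable fun m => ‖N n m‖ ^ 2 := by
  have h := (hN.rows n n).summable
  simp only [Complex.star_def, Complex.mul_conj, Complex.normSq_eq_norm_sq] at h
  exact_mod_cast h

theorem IsUnitaryMatrix.summable_col {N : Matrix ι ι ℂ} (hN : IsUnitaryMatrix N) (m : ι) :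
    Summable fun n => ‖N n m‖ ^ 2 := by
  have h := (hN.cols m m).summable
  simp only [Complex.star_def, Complex.conj_mul'] at h
  exact_mod_cast h

theorem IsUnitaryMatrix.memℓp_col {N : Matrix ι ι ℂ} (hN : IsUnitaryMatrix N) (m : ι) (x : H) :
    Memℓp (fun n => star (N n m) • x) 2 := by
  refine memℓp_gen ?_
  simpa [norm_smul, mul_pow] using (hN.summable_col m).mul_right (‖x‖ ^ 2)

/-- The column `m` of the conjugate of a unitary matrix, as an operator into `ℓ²(ι, H)`. -/
def IsUnitaryMatrix.columnIsometry {N : Matrix ι ι ℂ} (hN : IsUnitaryMatrix N) (m : ι) :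
    H →ₗᵢ[ℂ] lp (fun _ : ι => H) 2 :=
  LinearMap.isometryOfInner
    { toFun := fun x => ⟨fun n => star (N n m) • x, hN.memℓp_col m x⟩
      map_add' := fun x y => Subtype.ext (funext fun n => smul_add (star (N n m)) x y)
      map_smul' := fun c x => Subtype.ext (funext fun n => smul_comm (star (N n m)) c x) }
    fun x y => by
      refine (lp.hasSum_inner (𝕜 := ℂ) _ _).unique ?_
      have h := (hN.cols m m).mul_right ⟪x, y⟫_ℂ
      rw [if_pos rfl, one_mul] at h
      refine h.congr_fun fun n => ?_
      change ⟪star (N n m) • x, star (N n m) • y⟫_ℂ = _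
      rw [inner_smul_left, inner_smul_right, ← mul_assoc]
      simp [mul_comm]

theorem IsUnitaryMatrix.columnIsometry_apply {N : Matrix ι ι ℂ} (hN : IsUnitaryMatrix N) (m : ι)
    (x : H) (n : ι) : hN.columnIsometry m x n = star (N n m) • x := rfl

/-- Orthonormality of distinct columns is all that is needed. The family assembles into the isometry
`(aₘ) ↦ (∑ₘ conj(Nₙₘ) aₘ)ₙ` of `ℓ²(ι, H)`. -/
theorem IsUnitaryMatrix.orthogonalFamily {N : Matrix ι ι ℂ} (hN : IsUnitaryMatrix N) :
    OrthogonalFamily ℂ (fun _ : ι => H) fun m => hN.columnIsometry m := by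
  intro m k hmk x y
  refine (lp.hasSum_inner (𝕜 := ℂ) _ _).unique ?_
  have h := (hN.cols k m).mul_right ⟪x, y⟫_ℂ
  rw [if_neg (Ne.symm hmk), zero_mul] at h
  refine h.congr_fun fun n => ?_
  rw [columnIsometry_apply, columnIsometry_apply, inner_smul_left, inner_smul_right, ← mul_assoc]
  simp [mul_comm]

variable [CompleteSpace H]

/-- A unitary matrix preserves inner products of square-summable families of vectors. -/
theorem IsUnitaryMatrix.hasSum_inner {N : Matrix ι ι ℂ} (hN : IsUnitaryMatrix N)
    {a c a' c' : ι → H} (ha : Summable fun n => ‖a n‖ ^ 2) (hc : Summable fun n => ‖c n‖ ^ 2)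
    (ha' : ∀ n x, HasSum (fun m => N n m * ⟪a m, x⟫_ℂ) ⟪a' n, x⟫_ℂ)
    (hc' : ∀ n x, HasSum (fun m => N n m * ⟪c m, x⟫_ℂ) ⟪c' n, x⟫_ℂ) :
    HasSum (fun n => ⟪a' n, c' n⟫_ℂ) (∑' n, ⟪a n, c n⟫_ℂ) := by
  let T := hN.orthogonalFamily (H := H) |>.linearIsometry
  -- The hypotheses describe `v n` only weakly; coordinate evaluation identifies it with the `n`-th
  -- entry of `T u`. The conjugate entries in `T` become `N n m` in the antilinear slot of the inner
  -- product.
  have key : ∀ (u v : ι → H) (hu : Memℓp u 2),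
      (∀ n x, HasSum (fun m => N n m * ⟪u m, x⟫_ℂ) ⟪v n, x⟫_ℂ) → ∀ n, T ⟨u, hu⟩ n = v n := by
    intro u v hu huv n
    refine ext_inner_right ℂ fun x => ?_
    have h1 : HasSum (fun m => hN.columnIsometry m (u m)) (T ⟨u, hu⟩) :=
      hN.orthogonalFamily.hasSum_linearIsometry ⟨u, hu⟩
    have h2 := ((h1.mapL (lp.evalCLM ℂ (fun _ : ι => H) 2 n)).mapL (innerSL ℂ x)).star
    have h3 : HasSum (fun m => N n m * ⟪u m, x⟫_ℂ) ⟪T ⟨u, hu⟩ n, x⟫_ℂ := by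
      rw [← inner_conj_symm (T ⟨u, hu⟩ n) x]
      refine h2.congr_fun fun m => ?_
      change _ = star ⟪x, star (N n m) • u m⟫_ℂ
      rw [inner_smul_right, star_mul', star_star, ← inner_conj_symm (u m) x]
      rfl
    exact h3.unique (huv n x)
  have ha2 : Memℓp a 2 := memℓp_gen (by simpa using ha)
  have hc2 : Memℓp c 2 := memℓp_gen (by simpa using hc)
  have h1 := lp.hasSum_inner (𝕜 := ℂ) (T ⟨a, ha2⟩) (T ⟨c, hc2⟩)
  rw [T.inner_map_map, lp.inner_eq_tsum] at h1
  refine h1.congr_fun fun n => ?_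
  rw [key a a' ha2 ha' n, key c c' hc2 hc' n]

/-- With `A' = v A v*`, the matrix preserves the pairing of `(Xₙ* h)` with `(A' Xₙ* k)`. The
transformed vectors are `v Xₙ* u* h` and `A' v Xₙ* u* k = v A Xₙ* u* k`, and `v` cancels. -/
theorem tsum_inner_unitary_conj {X : ι → (H →L[ℂ] H)}
    (hX : ∀ h, Summable fun n => ‖star (X n) h‖ ^ 2) (u v : unitary (H →L[ℂ] H))
    {N : Matrix ι ι ℂ} (hN : IsUnitaryMatrix N)
    (hNX : ∀ n, HasWeakStarSum (fun m => N n m • X m)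
      ((u : H →L[ℂ] H) * X n * (v⁻¹ : unitary (H →L[ℂ] H)))) (A : H →L[ℂ] H) (h k : H) :
    ∑' n, ⟪star (X n) h, ((v : H →L[ℂ] H) * A * (v⁻¹ : unitary (H →L[ℂ] H))) (star (X n) k)⟫_ℂ =
      ∑' n, ⟪star (X n) ((u⁻¹ : unitary (H →L[ℂ] H)).1 h),
        A (star (X n) ((u⁻¹ : unitary (H →L[ℂ] H)).1 k))⟫_ℂ := by
  set A' : H →L[ℂ] H := (v : H →L[ℂ] H) * A * (v⁻¹ : unitary (H →L[ℂ] H)) with hA'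
  have hsum : ∀ (h : H) (n : ι) (x : H), HasSum (fun m => N n m * ⟪star (X m) h, x⟫_ℂ)
      ⟪star ((u : H →L[ℂ] H) * X n * (v⁻¹ : unitary (H →L[ℂ] H))) h, x⟫_ℂ := fun h n x => by
    rw [inner_star_left]
    refine ((hNX n).hasSum_inner h x).congr_fun fun m => ?_
    rw [inner_star_left, smul_apply, inner_smul_right]
  have hsumA : ∀ (h : H) (n : ι) (x : H), HasSum (fun m => N n m * ⟪A' (star (X m) h), x⟫_ℂ)
      ⟪A' (star ((u : H →L[ℂ] H) * X n * (v⁻¹ : unitary (H →L[ℂ] H))) h), x⟫_ℂ := fun h n x => by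
    have hA2 : ∀ y : H, ⟪A' y, x⟫_ℂ = ⟪y, star A' x⟫_ℂ := fun y => by
      rw [← inner_star_left, star_star]
    simpa only [hA2] using hsum h n (star A' x)
  have hXA : Summable fun n => ‖A' (star (X n) k)‖ ^ 2 := by
    refine Summable.of_nonneg_of_le (fun _ => sq_nonneg _) (fun n => ?_)
      ((hX k).mul_left (‖A'‖ ^ 2))
    rw [← mul_pow]
    exact pow_le_pow_left₀ (norm_nonneg _) (A'.le_opNorm _) 2
  rw [← (hN.hasSum_inner (hX h) hXA (hsum h) (hsumA k)).tsum_eq]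
  refine tsum_congr fun n => ?_
  have h1 : star ((u : H →L[ℂ] H) * X n * (v⁻¹ : unitary (H →L[ℂ] H))) =
      (v : H →L[ℂ] H) * star (X n) * (u⁻¹ : unitary (H →L[ℂ] H)) := by
    simp [coe_inv_unitary, mul_assoc]
  have h2 : A' * (v : H →L[ℂ] H) = (v : H →L[ℂ] H) * A := by
    simp [hA', coe_inv_unitary, mul_assoc]
  have h3 : ∀ y, A' ((v : H →L[ℂ] H) y) = (v : H →L[ℂ] H) (A y) := fun y =>
    congrArg (fun B : H →L[ℂ] H => B y) h2
  have h4 : ∀ y, ((v : H →L[ℂ] H) * star (X n) * (u⁻¹ : unitary (H →L[ℂ] H))) y =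
      (v : H →L[ℂ] H) (star (X n) ((u⁻¹ : unitary (H →L[ℂ] H)).1 y)) := fun _ => rfl
  rw [h1, h4, h4, h3, ← inner_star_left, ← opMul_apply, Unitary.coe_star_mul_self]
  rfl

end UnitaryMatrix

variable [CompleteSpace H]

theorem summable_of_hasWeakStarSum {ι : Type*} {X : ι → (H →L[ℂ] H)}
    (hX : ∃ S, HasWeakStarSum (fun n => X n * star (X n)) S) (h : H) :
    Summable fun n => ‖star (X n) h‖ ^ 2 := by
  obtain ⟨S, hS⟩ := hX
  have h1 := (hS.hasSum_inner h h).summable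
  have h2 : ∀ n, ⟪h, (X n * star (X n)) h⟫_ℂ = ((‖star (X n) h‖ ^ 2 : ℝ) : ℂ) := fun n => by
    have := inner_mul_mul_star (X n) 1 h h
    rw [mul_one] at this
    rw [this]
    change ⟪star (X n) h, star (X n) h⟫_ℂ = _
    rw [inner_self_eq_norm_sq_to_K]
    simp
  simp only [h2] at h1
  exact_mod_cast h1

/-- This reduces the transposed part to an ordinary Kraus sum for `W`, tested on `J k` and `J h` in
swapped order, so both parts can be treated alike. -/
theorem inner_conjOp_kraus {I : Type*} (b : HilbertBasis I ℂ H) (W A : H →L[ℂ] H) (h k : H) :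
    ⟪h, (conjOp b W * transpose b A * star (conjOp b W)) k⟫_ℂ =
      ⟪star W (J b k), A (star W (J b h))⟫_ℂ := by
  rw [inner_mul_mul_star, inner_transpose, star_conjOp, conjOp_apply, conjOp_apply, J_J, J_J]

/-- A map with a covariant Kraus representation is covariant. -/
theorem IsCovariantKraus.isCovariant {G : Type*} [Group G] {I : Type*} {b : HilbertBasis I ℂ H}
    {U : G →* unitary (H →L[ℂ] H)} {V : G → unitary (H →L[ℂ] H)}
    {α : G →* ((H →L[ℂ] H) ≃⋆ₐ[ℂ] (H →L[ℂ] H))}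
    (hαV : ∀ g A, α g A = (V g : H →L[ℂ] H) * A * ((V g)⁻¹ : unitary (H →L[ℂ] H)))
    {φ : (H →L[ℂ] H) →ₗ[ℂ] (H →L[ℂ] H)} {ι κ : Type*} {X : ι → (H →L[ℂ] H)}
    {W : κ → (H →L[ℂ] H)} (hφ : IsCovariantKraus b U V φ X W) : IsCovariant α U φ := by
  classical
  intro g A
  obtain ⟨P, Q, hP, hQ, h1⟩ := hφ.kraus A
  obtain ⟨P', Q', hP', hQ', h2⟩ := hφ.kraus (α g A)
  obtain ⟨N, hN, hNX⟩ := hφ.transform_X g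
  obtain ⟨M, hM, hMW⟩ := hφ.transform_W g
  ext k
  refine ext_inner_left ℂ fun h => ?_
  have hstar : ∀ x y : H, ⟪x, (U g : H →L[ℂ] H) y⟫_ℂ =
      ⟪((U g)⁻¹ : unitary (H →L[ℂ] H)).1 x, y⟫_ℂ := fun x y => by
    rw [coe_inv_unitary, inner_star_left]
  have hJ : ∀ x : H, J b (((U g)⁻¹ : unitary (H →L[ℂ] H)).1 x) =
      ((conjRep b U g)⁻¹ : unitary (H →L[ℂ] H)).1 (J b x) := fun x => by
    rw [← map_inv, ← map_inv, conjRep_apply, J_J]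
  rw [h1, h2, opMul_apply, opMul_apply, hstar, add_apply, add_apply, inner_add_right, inner_add_right]
  congr 1
  · rw [← (hP'.hasSum_inner h k).tsum_eq, ← (hP.hasSum_inner _ _).tsum_eq]
    simp only [inner_mul_mul_star]
    rw [hαV]
    convert tsum_inner_unitary_conj (summable_of_hasWeakStarSum hφ.summable_X) (U g) (V g) _ hNX A
      h k
    convert hN
  · rw [← (hQ'.hasSum_inner h k).tsum_eq, ← (hQ.hasSum_inner _ _).tsum_eq]
    simp only [inner_conjOp_kraus, hJ]
    rw [hαV]
    convert tsum_inner_unitary_conj (summable_of_hasWeakStarSum hφ.summable_W) (conjRep b U g)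
      (V g) _ hMW A (J b k) (J b h)
    convert hM

end CovDec

namespace CovDec

open Filter Topology

/-! ### Kraus families from positive semidefinite kernels -/

/-- Two total families with the same Gram matrix are related by a unitary operator. -/
theorem exists_linearIsometryEquiv_of_gram_eq {E Ω : Type*} [NormedAddCommGroup E]
    [InnerProductSpace ℂ E] [CompleteSpace E] {a a' : Ω → E}
    (h : ∀ i j, ⟪a' i, a' j⟫_ℂ = ⟪a i, a j⟫_ℂ)
    (ha : (Submodule.span ℂ (Set.range a)).topologicalClosure = ⊤)
    (ha' : (Submodule.span ℂ (Set.range a')).topologicalClosure = ⊤) :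
    ∃ R : E ≃ₗᵢ[ℂ] E, ∀ i, R (a i) = a' i := by
  have hdense : ∀ a : Ω → E, (Submodule.span ℂ (Set.range a)).topologicalClosure = ⊤ →
      DenseRange (Finsupp.linearCombination ℂ a) := fun a ha => by
    rw [← Submodule.dense_iff_topologicalClosure_eq_top, ← Finsupp.range_linearCombination] at ha
    exact ha
  -- The norm of a linear combination depends only on the Gram matrix, so the correspondence of the
  -- two families is isometric on spans and extends by density.
  have hnorm : ∀ c : Ω →₀ ℂ, ‖Finsupp.linearCombination ℂ a' ((LinearEquiv.refl ℂ (Ω →₀ ℂ)) c)‖ =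
      ‖Finsupp.linearCombination ℂ a c‖ := fun c => by
    have key : ∀ a : Ω → E, ((‖Finsupp.linearCombination ℂ a c‖ : ℂ)) ^ 2 =
        c.sum fun i z => c.sum fun j w => star z * (w * ⟪a i, a j⟫_ℂ) := fun a => by
      have h1 := inner_self_eq_norm_sq_to_K (𝕜 := ℂ) (Finsupp.linearCombination ℂ a c)
      rw [Finsupp.linearCombination_apply] at h1 ⊢
      refine h1.symm.trans ?_
      simp only [Finsupp.sum, sum_inner, inner_sum, inner_smul_left, inner_smul_right,
        Finset.mul_sum]
      rw [Finset.sum_comm]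
      refine Finset.sum_congr rfl fun i _ => Finset.sum_congr rfl fun j _ => ?_
      rw [Complex.star_def]
      ring
    have h2 : ((‖Finsupp.linearCombination ℂ a' c‖ : ℂ)) ^ 2 =
        (‖Finsupp.linearCombination ℂ a c‖ : ℂ) ^ 2 := by
      rw [key, key]
      simp only [h]
    exact (sq_eq_sq₀ (norm_nonneg _) (norm_nonneg _)).1 (by exact_mod_cast h2)
  refine ⟨(LinearEquiv.refl ℂ (Ω →₀ ℂ)).extendOfIsometry _ _ (hdense a ha) (hdense a' ha') hnorm,
    fun i => ?_⟩
  have h3 := (LinearEquiv.refl ℂ (Ω →₀ ℂ)).extendOfIsometry_eq _ _ (hdense a ha) (hdense a' ha') hnorm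
    (Finsupp.single i 1)
  simpa using h3

/-- Parseval for the vectors `R fₙ` gives the rows, and Parseval for `R⁻¹ fₙ` gives the columns. -/
theorem isUnitaryMatrix_of_linearIsometryEquiv {E ι : Type*} [NormedAddCommGroup E]
    [InnerProductSpace ℂ E] [DecidableEq ι] (f : HilbertBasis ι ℂ E) (R : E ≃ₗᵢ[ℂ] E) :
    IsUnitaryMatrix (Matrix.of fun n m => ⟪f m, R (f n)⟫_ℂ) := by
  constructor <;> intro n k
  · have h1 := f.hasSum_inner_mul_inner (R (f k)) (R (f n))
    rw [R.inner_map_map, orthonormal_iff_ite.1 f.orthonormal] at h1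
    simp only [@eq_comm _ n k]
    refine h1.congr_fun fun m => ?_
    rw [Matrix.of_apply, Matrix.of_apply, mul_comm, Complex.star_def, inner_conj_symm]
  · have h1 := f.hasSum_inner_mul_inner (R.symm (f k)) (R.symm (f n))
    rw [R.symm.inner_map_map, orthonormal_iff_ite.1 f.orthonormal] at h1
    simp only [@eq_comm _ n k]
    refine h1.congr_fun fun m => ?_
    rw [Matrix.of_apply, Matrix.of_apply, Complex.star_def, inner_conj_symm,
      ← R.inner_map_map _ (f m), ← R.inner_map_map (f m), R.apply_symm_apply,
      R.apply_symm_apply, mul_comm]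

theorem hasSum_norm_inner_sq {E I : Type*} [NormedAddCommGroup E] [InnerProductSpace ℂ E]
    (b : HilbertBasis I ℂ E) (z : E) : HasSum (fun i => ‖⟪b i, z⟫_ℂ‖ ^ 2) (‖z‖ ^ 2) := by
  have h1 := b.hasSum_inner_mul_inner z z
  rw [inner_self_eq_norm_sq_to_K] at h1
  have h2 : ∀ i, ⟪z, b i⟫_ℂ * ⟪b i, z⟫_ℂ = ((‖⟪b i, z⟫_ℂ‖ ^ 2 : ℝ) : ℂ) := fun i => by
    rw [← inner_conj_symm z (b i), Complex.conj_mul']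
    push_cast
    rfl
  simp only [h2] at h1
  refine Complex.hasSum_ofReal.1 ?_
  rw [Complex.ofReal_pow]
  exact h1

/-! ### The reproducing kernel Hilbert space as a space of operators -/

section RKHS

variable {H : Type*} [NormedAddCommGroup H] [InnerProductSpace ℂ H] [CompleteSpace H]
  {E : Type*} [NormedAddCommGroup E] [InnerProductSpace ℂ E] [CompleteSpace E] [RKHS ℂ E H H]

open RKHS

theorem inner_kerFun_kerFun (x y h k : H) :
    ⟪kerFun E x h, kerFun E y k⟫_ℂ = ⟪h, kernel E x y k⟫_ℂ := by
  rw [kerFun_inner, kerFun_apply]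

/-- The elements of a reproducing kernel Hilbert space, as bounded operators, when the kernel is
sesquilinear and bounded. -/
theorem exists_operator_of_kernel
    (hadd : ∀ x y y', kernel E x (y + y') = kernel E x y + kernel E x y')
    (hsmul : ∀ x (c : ℂ) y, kernel E x (c • y) = star c • kernel E x y)
    {C : ℝ} (hC : ∀ x, ‖kernel E x x‖ ≤ C * ‖x‖ ^ 2) (f : E) :
    ∃ A : H →L[ℂ] H, ∀ x, A x = f x := by
  -- Since `⟪h, f x⟫ = ⟪kerFun x h, f⟫`, linearity of `f` comes from conjugate-linearity of the
  -- kernel in its second variable.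
  have h1 : ∀ (x x' h : H), kerFun E (x + x') h = kerFun E x h + kerFun E x' h := fun x x' h => by
    ext z
    rw [RKHS.coe_add, Pi.add_apply, kerFun_apply, kerFun_apply, kerFun_apply, hadd, add_apply]
  have h2 : ∀ (c : ℂ) (x h : H), kerFun E (c • x) h = star c • kerFun E x h := fun c x h => by
    ext z
    rw [RKHS.coe_smul, Pi.smul_apply, kerFun_apply, kerFun_apply, hsmul, smul_apply]
  refine ⟨LinearMap.mkContinuous
    { toFun := f
      map_add' := fun x x' => ext_inner_left ℂ fun h => ?_
      map_smul' := fun c x => ext_inner_left ℂ fun h => ?_ } (‖f‖ * √C) fun x => ?_, fun x => rfl⟩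
  · rw [inner_add_right, ← kerFun_inner, ← kerFun_inner, ← kerFun_inner, h1, inner_add_left]
  · rw [RingHom.id_apply, inner_smul_right, ← kerFun_inner, ← kerFun_inner, h2, inner_smul_left]
    simp
  · refine (norm_apply_le f x).trans ?_
    rw [mul_assoc]
    refine mul_le_mul_of_nonneg_left ?_ (norm_nonneg _)
    rw [← Real.sqrt_sq (norm_nonneg x), ← Real.sqrt_mul' _ (sq_nonneg _)]
    exact Real.sqrt_le_sqrt (hC x)

/-- A pair of unitary operators that preserves the kernel acts on the reproducing kernel Hilbert
space. -/
theorem exists_linearIsometryEquiv_of_kernel (u v : unitary (H →L[ℂ] H))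
    (huv : ∀ x y, kernel E ((v : H →L[ℂ] H) x) ((v : H →L[ℂ] H) y) =
      (u : H →L[ℂ] H) * kernel E x y * (u⁻¹ : unitary (H →L[ℂ] H))) :
    ∃ R : E ≃ₗᵢ[ℂ] E, ∀ f x, R f x = (u : H →L[ℂ] H) (f ((v⁻¹ : unitary (H →L[ℂ] H)).1 x)) := by
  have hinv : ∀ (w : unitary (H →L[ℂ] H)) (x : H),
      (w : H →L[ℂ] H) ((w⁻¹ : unitary (H →L[ℂ] H)).1 x) = x := fun w x => by
    rw [coe_inv_unitary, ← opMul_apply, ← Unitary.coe_star, Unitary.coe_mul_star_self]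
    rfl
  have hinv' : ∀ (w : unitary (H →L[ℂ] H)) (x : H),
      (w⁻¹ : unitary (H →L[ℂ] H)).1 ((w : H →L[ℂ] H) x) = x := fun w x => by
    rw [coe_inv_unitary, ← opMul_apply, Unitary.coe_star_mul_self]
    rfl
  -- Invariance of the kernel means that `kerFun x h` and `kerFun (v x) (u h)` have the same Gram
  -- matrix; the unitary operator carries the first total family to the second.
  have hker : ∀ x y h k : H, ⟪kerFun E ((v : H →L[ℂ] H) x) ((u : H →L[ℂ] H) h),
      kerFun E ((v : H →L[ℂ] H) y) ((u : H →L[ℂ] H) k)⟫_ℂ = ⟪kerFun E x h, kerFun E y k⟫_ℂ := by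
    intro x y h k
    rw [inner_kerFun_kerFun, inner_kerFun_kerFun, huv, opMul_apply, opMul_apply, hinv',
      ← inner_star_left, ← opMul_apply, Unitary.coe_star_mul_self]
    rfl
  have hd := kerFun_dense E
  have hrange : (Set.range fun p : H × H => kerFun E p.1 p.2) = {kerFun E x h | (x) (h)} := by
    ext z
    simp
  have hrange' : (Set.range fun p : H × H => kerFun E ((v : H →L[ℂ] H) p.1)
      ((u : H →L[ℂ] H) p.2)) = {kerFun E x h | (x) (h)} := by
    ext z
    constructor
    · rintro ⟨p, rfl⟩
      exact ⟨_, _, rfl⟩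
    · rintro ⟨x, h, rfl⟩
      exact ⟨((v⁻¹ : unitary (H →L[ℂ] H)).1 x, (u⁻¹ : unitary (H →L[ℂ] H)).1 h), by
        simp only [hinv]⟩
  obtain ⟨R, hR⟩ := exists_linearIsometryEquiv_of_gram_eq
    (a := fun p : H × H => kerFun E p.1 p.2)
    (a' := fun p : H × H => kerFun E ((v : H →L[ℂ] H) p.1) ((u : H →L[ℂ] H) p.2))
    (fun p q => hker p.1 q.1 p.2 q.2)
    (by rw [hrange, hd]) (by rw [hrange', hd])
  refine ⟨R, fun f x => ext_inner_left ℂ fun h => ?_⟩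
  have h1 := hR ((v⁻¹ : unitary (H →L[ℂ] H)).1 x, (u⁻¹ : unitary (H →L[ℂ] H)).1 h)
  simp only [hinv] at h1
  rw [← kerFun_inner, ← h1, R.inner_map_map, kerFun_inner, coe_inv_unitary u, inner_star_left]

end RKHS

open scoped Classical in
/-- A bounded positive semidefinite sesquilinear kernel has a Kraus family, on which every pair of
unitary operators that preserves the kernel acts by a unitary matrix. -/
theorem exists_kraus_of_kernel {H : Type u} [NormedAddCommGroup H] [InnerProductSpace ℂ H]
    [CompleteSpace H] {I : Type*} (b : HilbertBasis I ℂ H)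
    (K : Matrix H H (H →L[ℂ] H)) (hK : K.PosSemidef)
    (hadd : ∀ x y y', K x (y + y') = K x y + K x y')
    (hsmul : ∀ x (c : ℂ) y, K x (c • y) = star c • K x y)
    {C : ℝ} (hC : ∀ x, ‖K x x‖ ≤ C * ‖x‖ ^ 2)
    (hrow : ∀ F : Finset I, ‖∑ i ∈ F, K (b i) (b i)‖ ≤ C) :
    ∃ (ι : Type u) (X : ι → (H →L[ℂ] H)), RowBounded X ∧ (∀ n, X n ≠ 0) ∧
      (∀ x y h k, HasSum (fun n => ⟪h, X n x⟫_ℂ * ⟪X n y, k⟫_ℂ) ⟪h, K x y k⟫_ℂ) ∧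
      ∀ u v : unitary (H →L[ℂ] H),
        (∀ x y, K ((v : H →L[ℂ] H) x) ((v : H →L[ℂ] H) y) =
          (u : H →L[ℂ] H) * K x y * (u⁻¹ : unitary (H →L[ℂ] H))) →
        ∃ N : Matrix ι ι ℂ, IsUnitaryMatrix N ∧ ∀ n, HasWeakStarSum (fun m => N n m • X m)
          ((u : H →L[ℂ] H) * X n * (v⁻¹ : unitary (H →L[ℂ] H))) := by
  have : Fact K.PosSemidef := ⟨hK⟩
  -- The Kraus operators are the members of this basis; the kernel identity `hsum` is Parseval for
  -- two kernel functions.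
  obtain ⟨w, f, -⟩ := exists_hilbertBasis ℂ (RKHS.OfKernel K)
  have hker : RKHS.kernel (RKHS.OfKernel K) = K := RKHS.OfKernel.kernel_ofKernel
  have hop := exists_operator_of_kernel (E := RKHS.OfKernel K) (by rwa [hker])
    (by rwa [hker]) (C := C) (by rwa [hker])
  choose A hA using hop
  have hsum : ∀ x y h k, HasSum (fun n => ⟪h, A (f n) x⟫_ℂ * ⟪A (f n) y, k⟫_ℂ) ⟪h, K x y k⟫_ℂ := by
    intro x y h k
    have h1 := f.hasSum_inner_mul_inner (RKHS.kerFun _ x h) (RKHS.kerFun _ y k)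
    rw [inner_kerFun_kerFun, hker] at h1
    simpa only [RKHS.kerFun_inner, RKHS.inner_kerFun, ← hA] using h1
  -- Expand `‖(A fₙ)* h‖²` in the basis `b` and exchange the sums: each finite set `F` of basis
  -- vectors contributes at most `⟪h, ∑_{i ∈ F} K (b i) (b i) h⟫`, which `hrow` bounds uniformly in
  -- `F`.
  have hbdd : RowBounded fun n => A (f n) := by
    refine ⟨C, fun h s => ?_⟩
    have h1 : HasSum (fun i => ∑ n ∈ s, ‖⟪b i, star (A (f n)) h⟫_ℂ‖ ^ 2)
        (∑ n ∈ s, ‖star (A (f n)) h‖ ^ 2) := by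
      exact hasSum_sum fun n _ => hasSum_norm_inner_sq b _
    refine hasSum_le_of_sum_le h1 fun F => ?_
    have h2 : HasSum (fun n => ∑ i ∈ F, ‖⟪b i, star (A (f n)) h⟫_ℂ‖ ^ 2)
        (∑ i ∈ F, (⟪h, K (b i) (b i) h⟫_ℂ).re) := by
      refine hasSum_sum fun i _ => ?_
      refine (Complex.hasSum_re (hsum (b i) (b i) h h)).congr_fun fun n => ?_
      rw [← inner_conj_symm h, Complex.conj_mul', norm_inner_symm, inner_star_left,
        norm_inner_symm, ← Complex.ofReal_pow, Complex.ofReal_re]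
    rw [Finset.sum_comm]
    calc ∑ n ∈ s, ∑ i ∈ F, ‖⟪b i, star (A (f n)) h⟫_ℂ‖ ^ 2
        ≤ ∑ i ∈ F, (⟪h, K (b i) (b i) h⟫_ℂ).re :=
          sum_le_hasSum s (fun n _ => Finset.sum_nonneg fun i _ => sq_nonneg _) h2
      _ = (⟪h, (∑ i ∈ F, K (b i) (b i)) h⟫_ℂ).re := by
          rw [sum_apply, inner_sum, Complex.re_sum]
      _ ≤ ‖h‖ * ‖(∑ i ∈ F, K (b i) (b i)) h‖ :=
          (Complex.re_le_norm _).trans (norm_inner_le_norm _ _)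
      _ ≤ ‖h‖ * (C * ‖h‖) := by
          refine mul_le_mul_of_nonneg_left ?_ (norm_nonneg _)
          exact (ContinuousLinearMap.le_opNorm _ _).trans
            (mul_le_mul_of_nonneg_right (hrow F) (norm_nonneg _))
      _ = C * ‖h‖ ^ 2 := by ring
  refine ⟨w, fun n => A (f n), hbdd, fun n h0 => ?_, hsum, fun u v huv => ?_⟩
  · have h1 : f n = 0 := by
      ext x
      rw [← hA]
      exact (congrArg (fun B : H →L[ℂ] H => B x) h0).trans (congrFun RKHS.coe_zero x).symm
    exact f.orthonormal.ne_zero n h1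
  · obtain ⟨R, hR⟩ := exists_linearIsometryEquiv_of_kernel (E := RKHS.OfKernel K) u v
      (by rwa [hker])
    have hN := @isUnitaryMatrix_of_linearIsometryEquiv _ _ _ _ (Classical.decEq _) f R
    refine ⟨_, hN, fun n => ?_⟩
    refine hbdd.hasWeakStarSum_smul
      ((isUnitaryMatrix_of_linearIsometryEquiv f R).summable_row n) fun h k => ?_
    have h1 := f.hasSum_inner_mul_inner (RKHS.kerFun _ k h) (R (f n))
    rw [RKHS.kerFun_inner, hR, ← hA] at h1
    refine h1.congr_fun fun m => ?_
    rw [RKHS.kerFun_inner, ← hA, mul_comm]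
    rfl

end CovDec

namespace CovDec

open Filter Topology MeasureTheory InnerProductSpace

/-! ### Completely positive maps on operators of rank one -/

section CP

variable {H : Type*} [NormedAddCommGroup H] [InnerProductSpace ℂ H] [CompleteSpace H]
  {φ : (H →L[ℂ] H) →ₗ[ℂ] (H →L[ℂ] H)}

theorem IsCP.continuous (hφ : IsCP φ) : Continuous φ := by
  obtain ⟨ψ, rfl⟩ := hφ
  exact map_continuous ψ

theorem IsCP.exists_bound (hφ : IsCP φ) : ∃ C : ℝ, 0 ≤ C ∧ ∀ A, ‖φ A‖ ≤ C * ‖A‖ :=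
  ⟨‖(⟨φ, hφ.continuous⟩ : (H →L[ℂ] H) →L[ℂ] (H →L[ℂ] H))‖, norm_nonneg _, fun A =>
    (⟨φ, hφ.continuous⟩ : (H →L[ℂ] H) →L[ℂ] (H →L[ℂ] H)).le_opNorm A⟩

theorem IsCP.apply_star (hφ : IsCP φ) (A : H →L[ℂ] H) : φ (star A) = star (φ A) := by
  obtain ⟨ψ, rfl⟩ := hφ
  exact map_star ψ A

theorem star_rankOne (x y : H) : star (rankOne ℂ x y) = rankOne ℂ y x := by
  rw [ContinuousLinearMap.star_eq_adjoint, adjoint_rankOne]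

/-- Nonnegative matrices are generated additively by the `Q* Q`, for which the double sum is `∑ₖ ‖∑ᵢ
Qₖᵢ hᵢ‖²`. -/
theorem re_sum_inner_nonneg_of_cstarMatrix_nonneg {n : Type*} [Fintype n]
    {M : CStarMatrix n n (H →L[ℂ] H)} (hM : 0 ≤ M) (h : n → H) :
    0 ≤ (∑ i, ∑ j, ⟪h i, M i j (h j)⟫_ℂ).re := by
  refine AddSubmonoid.closure_induction (motive := fun M _ =>
    0 ≤ (∑ i, ∑ j, ⟪h i, M i j (h j)⟫_ℂ).re) ?_ ?_ ?_ (StarOrderedRing.nonneg_iff.1 hM)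
  · rintro _ ⟨Q, rfl⟩
    have h2 : ∀ i j, ⟪h i, (star Q * Q) i j (h j)⟫_ℂ = ∑ k, ⟪Q k i (h i), Q k j (h j)⟫_ℂ := by
      intro i j
      rw [CStarMatrix.mul_apply, sum_apply, inner_sum]
      refine Finset.sum_congr rfl fun k _ => ?_
      rw [CStarMatrix.star_apply, opMul_apply, ← inner_star_left, star_star]
    have h1 : ∑ i, ∑ j, ⟪h i, (star Q * Q) i j (h j)⟫_ℂ =
        ∑ k, ⟪∑ i, Q k i (h i), ∑ j, Q k j (h j)⟫_ℂ := by
      simp only [h2, sum_inner, inner_sum]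
      rw [Finset.sum_comm' (t' := Finset.univ) (s' := fun _ => Finset.univ) (by simp)]
      refine (Finset.sum_congr rfl fun j _ => Finset.sum_comm).trans ?_
      rw [Finset.sum_comm]
    rw [h1, Complex.re_sum]
    exact Finset.sum_nonneg fun k _ => inner_self_nonneg (𝕜 := ℂ)
  · simp
  · intro M N _ _ hM hN
    simp only [CStarMatrix.add_apply, add_apply, inner_add_right, Finset.sum_add_distrib,
      Complex.add_re]
    exact add_nonneg hM hN

theorem IsCP.re_sum_inner_nonneg (hφ : IsCP φ) {Ω : Type*} (s : Finset Ω) (y h : Ω → H) :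
    0 ≤ (∑ i ∈ s, ∑ j ∈ s, ⟪h i, φ (rankOne ℂ (y i) (y j)) (h j)⟫_ℂ).re := by
  rcases s.eq_empty_or_nonempty with rfl | hs
  · simp
  rcases subsingleton_or_nontrivial H with hH | hH
  · have : ∀ i j, ⟪h i, φ (rankOne ℂ (y i) (y j)) (h j)⟫_ℂ = 0 := fun i j => by
      rw [Subsingleton.elim (h i) 0, inner_zero_left]
    simp [this]
  obtain ⟨ψ, rfl⟩ := hφ
  obtain ⟨e, he⟩ := exists_ne (0 : H)
  -- All rows of `B` are equal, so `B* B` is the matrix of the `|yᵢ⟩⟨yⱼ|` times `card s * ‖e‖²`, a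
  -- positive factor that is divided out at the end.
  let B : CStarMatrix s s (H →L[ℂ] H) := CStarMatrix.ofMatrix fun _ j => rankOne ℂ e (y j)
  have h1 := re_sum_inner_nonneg_of_cstarMatrix_nonneg
    (ψ.map_cstarMatrix_nonneg (star B * B) (star_mul_self_nonneg B)) (fun i => h i)
  have h2 : ∀ i j : s, (star B * B) i j =
      ((s.card * ‖e‖ ^ 2 : ℝ) : ℂ) • rankOne ℂ (y i) (y j) := by
    intro i j
    rw [CStarMatrix.mul_apply]
    have h3 : ∀ k : s, star B i k * B k j = ((‖e‖ ^ 2 : ℝ) : ℂ) • rankOne ℂ (y i) (y j) := by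
      intro k
      rw [CStarMatrix.star_apply]
      change star (rankOne ℂ e (y i)) * rankOne ℂ e (y j) = _
      rw [star_rankOne]
      ext z
      simp [smul_smul, mul_comm]
    simp only [h3, Finset.sum_const, Finset.card_univ, Fintype.card_coe]
    rw [← Nat.cast_smul_eq_nsmul ℂ, smul_smul]
    push_cast
    rfl
  have h4 : ∑ i : s, ∑ j : s, ⟪h i, (star B * B).map ψ i j (h j)⟫_ℂ =
      ((s.card * ‖e‖ ^ 2 : ℝ) : ℂ) *
        ∑ i ∈ s, ∑ j ∈ s, ⟪h i, ψ.toLinearMap (rankOne ℂ (y i) (y j)) (h j)⟫_ℂ := by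
    rw [← Finset.sum_coe_sort s, Finset.mul_sum]
    refine Finset.sum_congr rfl fun i _ => ?_
    rw [← Finset.sum_coe_sort s, Finset.mul_sum]
    refine Finset.sum_congr rfl fun j _ => ?_
    rw [CStarMatrix.map_apply, h2]
    have h5 : ψ (((s.card * ‖e‖ ^ 2 : ℝ) : ℂ) • rankOne ℂ (y i) (y j)) =
        ((s.card * ‖e‖ ^ 2 : ℝ) : ℂ) • ψ.toLinearMap (rankOne ℂ (y i) (y j)) :=
      map_smul ψ.toLinearMap _ _
    rw [h5, smul_apply, inner_smul_right]
  rw [h4, Complex.re_ofReal_mul] at h1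
  refine nonneg_of_mul_nonneg_right h1 ?_
  have := hs.card_pos
  positivity

end CP

/-! ### Averaging over a compact group -/

section Continuity

variable {H : Type*} [NormedAddCommGroup H] [InnerProductSpace ℂ H]

theorem continuous_of_weak_of_norm {X : Type*} [TopologicalSpace X] {f : X → H}
    (hw : ∀ x, Continuous fun g => ⟪x, f g⟫_ℂ) (hn : Continuous fun g => ⟪f g, f g⟫_ℂ) :
    Continuous f := by
  refine continuous_iff_continuousAt.2 fun g₀ => ?_
  have h1 : Continuous fun g => (⟪f g, f g⟫_ℂ).re - 2 * (⟪f g₀, f g⟫_ℂ).re + ‖f g₀‖ ^ 2 := by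
    have := hw (f g₀)
    fun_prop
  have h2 : ∀ g, ‖f g - f g₀‖ ^ 2 =
      (⟪f g, f g⟫_ℂ).re - 2 * (⟪f g₀, f g⟫_ℂ).re + ‖f g₀‖ ^ 2 := fun g => by
    rw [norm_sub_sq (𝕜 := ℂ), ← inner_self_eq_norm_sq (𝕜 := ℂ) (f g), inner_re_symm (𝕜 := ℂ) (f g) (f g₀)]
    rfl
  have h3 : Tendsto (fun g => ‖f g - f g₀‖ ^ 2) (𝓝 g₀) (𝓝 0) := by
    have h4 := h1.tendsto g₀
    simp only [← h2] at h4
    simpa using h4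
  have h5 := (Real.continuous_sqrt.tendsto 0).comp h3
  rw [Real.sqrt_zero] at h5
  refine tendsto_iff_norm_sub_tendsto_zero.2 (h5.congr fun g => ?_)
  exact Real.sqrt_sq (norm_nonneg _)

variable [CompleteSpace H]

theorem continuous_unitary_apply {G : Type*} [TopologicalSpace G] {U : G → unitary (H →L[ℂ] H)}
    (hU : ∀ x : H, Continuous fun g => (U g : H →L[ℂ] H) x) {f : G → H} (hf : Continuous f) :
    Continuous fun g => (U g : H →L[ℂ] H) (f g) := by
  refine continuous_iff_continuousAt.2 fun g₀ => ?_
  have h1 : Tendsto (fun g => ‖f g - f g₀‖ + ‖(U g : H →L[ℂ] H) (f g₀) -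
      (U g₀ : H →L[ℂ] H) (f g₀)‖) (𝓝 g₀) (𝓝 (0 + 0)) :=
    (tendsto_iff_norm_sub_tendsto_zero.1 (hf.tendsto g₀)).add
      (tendsto_iff_norm_sub_tendsto_zero.1 ((hU (f g₀)).tendsto g₀))
  rw [add_zero] at h1
  refine tendsto_iff_norm_sub_tendsto_zero.2
    (squeeze_zero (fun _ => norm_nonneg _) (fun g => ?_) h1)
  rw [← Unitary.norm_map (U g) (f g - f g₀), map_sub]
  exact norm_sub_le_norm_sub_add_norm_sub _ _ _

variable {G : Type*} [Group G]
  {V : G → unitary (H →L[ℂ] H)} {α : G →* ((H →L[ℂ] H) ≃⋆ₐ[ℂ] (H →L[ℂ] H))}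

theorem action_rankOne
    (hαV : ∀ g A, α g A = (V g : H →L[ℂ] H) * A * ((V g)⁻¹ : unitary (H →L[ℂ] H)))
    (g : G) (x y : H) : α g (rankOne ℂ x y) =
      rankOne ℂ ((V g : H →L[ℂ] H) x) ((V g : H →L[ℂ] H) y) := by
  ext z
  rw [hαV, opMul_apply, opMul_apply, rankOne_apply, rankOne_apply, map_smul, coe_inv_unitary,
    ← inner_star_left, star_star]

variable [TopologicalSpace G]

/-- Weak continuity for `A* A` gives continuity of `‖α g A v‖² = ⟪v, α g (A* A) v⟫`, which upgrades
weak to strong continuity. -/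
theorem continuous_action_apply
    (hα_cont : ∀ (A : H →L[ℂ] H) (x y : H), Continuous fun g => inner ℂ x (α g A y))
    (A : H →L[ℂ] H) (v : H) : Continuous fun g => α g A v := by
  refine continuous_of_weak_of_norm (fun x => hα_cont A x v) ?_
  refine (hα_cont (star A * A) v v).congr fun g => ?_
  have h1 : α g (star A) = star (α g A) := (α g).map_star' A
  rw [map_mul, h1, opMul_apply, ← inner_star_left, star_star]

/-- The phases of `V` are uncontrolled, so `V g x` may be discontinuous. With `e = V g₀ x` and `c g
= ⟪V g x, e⟫`, however, the vectors `α g (|z⟩⟨x|) e = c g • V g z` are continuous in `g`. Those for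
`z = x` and `z = y` form the rank-one operator `|c g|² α g (|x⟩⟨y|)`, and `|c g|²` is continuous and
nonzero at `g₀`. -/
theorem continuous_action_rankOne
    (hαV : ∀ g A, α g A = (V g : H →L[ℂ] H) * A * ((V g)⁻¹ : unitary (H →L[ℂ] H)))
    (hα_cont : ∀ (A : H →L[ℂ] H) (x y : H), Continuous fun g => inner ℂ x (α g A y))
    (x y : H) : Continuous fun g => α g (rankOne ℂ x y) := by
  rcases eq_or_ne x 0 with rfl | hx
  · simpa using continuous_const
  refine continuous_iff_continuousAt.2 fun g₀ => ?_
  set e : H := (V g₀ : H →L[ℂ] H) x with he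
  have hnorm : ‖e‖ = ‖x‖ := Unitary.norm_map _ _
  let c : G → ℂ := fun g => ⟪(V g : H →L[ℂ] H) x, e⟫_ℂ
  have hw : ∀ z g, α g (rankOne ℂ z x) e = c g • (V g : H →L[ℂ] H) z := fun z g => by
    rw [action_rankOne hαV, rankOne_apply]
  have hc : ∀ g, ⟪e, α g (rankOne ℂ x x) e⟫_ℂ = c g * star (c g) := fun g => by
    rw [hw, inner_smul_right, Complex.star_def, inner_conj_symm]
  have hcc : Continuous fun g => c g * star (c g) := (hα_cont _ e e).congr hc
  have hc0 : c g₀ * star (c g₀) ≠ 0 := by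
    have : c g₀ ≠ 0 := by
      change ⟪e, e⟫_ℂ ≠ 0
      rw [inner_self_ne_zero, ← norm_ne_zero_iff, hnorm, norm_ne_zero_iff]
      exact hx
    exact mul_ne_zero this (star_ne_zero.2 this)
  have h1 : ∀ g, rankOne ℂ (α g (rankOne ℂ x x) e) (α g (rankOne ℂ y x) e) =
      (c g * star (c g)) • α g (rankOne ℂ x y) := fun g => by
    rw [hw, hw, action_rankOne hαV]
    simp [smul_smul]
  have h2 : Continuous fun g => rankOne ℂ (α g (rankOne ℂ x x) e) (α g (rankOne ℂ y x) e) := by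
    have h3 := continuous_action_apply hα_cont (rankOne ℂ x x) e
    have h4 := continuous_action_apply hα_cont (rankOne ℂ y x) e
    exact ((ContinuousLinearMap.smulRightL ℂ H H).continuous.comp
      ((innerSL ℂ).continuous.comp h4)).clm_apply h3
  have h5 : ContinuousAt (fun g => (c g * star (c g))⁻¹ •
      rankOne ℂ (α g (rankOne ℂ x x) e) (α g (rankOne ℂ y x) e)) g₀ :=
    (hcc.continuousAt.inv₀ hc0).smul h2.continuousAt
  refine h5.congr ?_
  filter_upwards [hcc.continuousAt.eventually_ne hc0] with g hg
  rw [h1, smul_smul, inv_mul_cancel₀ hg, one_smul]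

end Continuity

end CovDec

namespace CovDec

open Filter Topology MeasureTheory InnerProductSpace

/-! ### Haar averages and the averaged kernel -/

section Average

theorem norm_sum_rankOne_le {H I : Type*} [NormedAddCommGroup H] [InnerProductSpace ℂ H] (b : HilbertBasis I ℂ H) (F : Finset I) :
    ‖∑ i ∈ F, rankOne ℂ (b i) (b i)‖ ≤ 1 := by
  refine ContinuousLinearMap.opNorm_le_bound _ zero_le_one fun x => ?_
  rw [one_mul, ← sq_le_sq₀ (norm_nonneg _) (norm_nonneg _)]
  have h1 : (∑ i ∈ F, rankOne ℂ (b i) (b i)) x = ∑ i ∈ F, ⟪b i, x⟫_ℂ • b i := by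
    simp [sum_apply]
  have h2 : ‖∑ i ∈ F, ⟪b i, x⟫_ℂ • b i‖ ^ 2 = ∑ i ∈ F, ‖⟪b i, x⟫_ℂ‖ ^ 2 := by
    rw [← inner_self_eq_norm_sq (𝕜 := ℂ), b.orthonormal.inner_sum]
    simp only [Complex.conj_mul']
    norm_cast
  rw [h1, h2]
  exact b.orthonormal.sum_inner_products_le x


variable {G : Type*} [Group G] {H : Type*} [NormedAddCommGroup H] [InnerProductSpace ℂ H] [CompleteSpace H]
  {U : G →* unitary (H →L[ℂ] H)} {V : G → unitary (H →L[ℂ] H)}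
  {α : G →* ((H →L[ℂ] H) ≃⋆ₐ[ℂ] (H →L[ℂ] H))} {φ : (H →L[ℂ] H) →ₗ[ℂ] (H →L[ℂ] H)}

theorem norm_action_le
    (hαV : ∀ g A, α g A = (V g : H →L[ℂ] H) * A * ((V g)⁻¹ : unitary (H →L[ℂ] H)))
    (g : G) (A : H →L[ℂ] H) : ‖α g A‖ ≤ ‖A‖ := by
  refine ContinuousLinearMap.opNorm_le_bound _ (norm_nonneg _) fun x => ?_
  rw [hαV, opMul_apply, opMul_apply, Unitary.norm_map]
  refine (A.le_opNorm _).trans_eq ?_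
  rw [Unitary.norm_map]

/-- The integrand of the average of a map over a group action. -/
def twirl (U : G →* unitary (H →L[ℂ] H)) (α : G →* ((H →L[ℂ] H) ≃⋆ₐ[ℂ] (H →L[ℂ] H)))
    (φ : (H →L[ℂ] H) →ₗ[ℂ] (H →L[ℂ] H)) (A : H →L[ℂ] H) (g : G) : H →L[ℂ] H :=
  ((U g)⁻¹ : unitary (H →L[ℂ] H)) * φ (α g A) * (U g : H →L[ℂ] H)

theorem norm_twirl_apply_le
    (hαV : ∀ g A, α g A = (V g : H →L[ℂ] H) * A * ((V g)⁻¹ : unitary (H →L[ℂ] H)))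
    {C : ℝ} (hC0 : 0 ≤ C) (hC : ∀ A, ‖φ A‖ ≤ C * ‖A‖) (A : H →L[ℂ] H) (g : G) (h : H) :
    ‖twirl U α φ A g h‖ ≤ C * ‖A‖ * ‖h‖ := by
  rw [twirl, opMul_apply, opMul_apply, Unitary.norm_map]
  refine (ContinuousLinearMap.le_opNorm _ _).trans ?_
  rw [Unitary.norm_map]
  refine mul_le_mul_of_nonneg_right ((hC _).trans ?_) (norm_nonneg _)
  exact mul_le_mul_of_nonneg_left (norm_action_le hαV g A) hC0

theorem inner_twirl (A : H →L[ℂ] H) (g : G) (h k : H) : ⟪h, twirl U α φ A g k⟫_ℂ =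
    ⟪(U g : H →L[ℂ] H) h, φ (α g A) ((U g : H →L[ℂ] H) k)⟫_ℂ := by
  rw [twirl, opMul_apply, opMul_apply, coe_inv_unitary, ← inner_star_left, star_star]

/-- The action on the argument becomes a right translation of the group variable, which a
right-invariant measure ignores; this is the covariance of the average. -/
theorem twirl_action (A : H →L[ℂ] H) (g g₀ : G) : twirl U α φ (α g₀ A) g =
    (U g₀ : H →L[ℂ] H) * twirl U α φ A (g * g₀) * ((U g₀)⁻¹ : unitary (H →L[ℂ] H)) := by
  have h1 : α g (α g₀ A) = α (g * g₀) A := by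
    rw [map_mul]
    rfl
  have h2 : U g = U (g * g₀) * (U g₀)⁻¹ := by simp
  have h3 : (U g)⁻¹ = U g₀ * (U (g * g₀))⁻¹ := by simp
  rw [twirl, twirl, h1, h3, h2, Submonoid.coe_mul, Submonoid.coe_mul]
  simp only [mul_assoc]

variable [TopologicalSpace G] [IsTopologicalGroup G]

theorem continuous_twirl (hU : ∀ x : H, Continuous fun g => (U g : H →L[ℂ] H) x)
    (hφ : Continuous φ) {A : H →L[ℂ] H} (hA : Continuous fun g => α g A) (h : H) :
    Continuous fun g => twirl U α φ A g h := by
  have h1 : ∀ x : H, Continuous fun g => (((U g)⁻¹ : unitary (H →L[ℂ] H)) : H →L[ℂ] H) x := by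
    intro x
    refine ((hU x).comp continuous_inv).congr fun g => ?_
    rw [Function.comp_apply, map_inv]
  exact continuous_unitary_apply h1 ((hφ.comp hA).clm_apply (hU h))

variable [CompactSpace G] [MeasurableSpace G] [BorelSpace G] (μ : Measure G) [IsProbabilityMeasure μ]

theorem integrable_twirl (hU : ∀ x : H, Continuous fun g => (U g : H →L[ℂ] H) x)
    (hφ : Continuous φ) {A : H →L[ℂ] H} (hA : Continuous fun g => α g A) (h : H) :
    Integrable (fun g => twirl U α φ A g h) μ :=
  (continuous_twirl hU hφ hA h).integrable_of_hasCompactSupport (.of_compactSpace _)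

/-- Norm continuity of the orbit of `A` is required because `φ` is only norm continuous, whereas a
general orbit is only known to be strongly continuous. The integral is taken vector by vector. -/
theorem exists_average (hU : ∀ x : H, Continuous fun g => (U g : H →L[ℂ] H) x)
    (hαV : ∀ g A, α g A = (V g : H →L[ℂ] H) * A * ((V g)⁻¹ : unitary (H →L[ℂ] H)))
    (hφ : Continuous φ) {C : ℝ} (hC0 : 0 ≤ C) (hC : ∀ A, ‖φ A‖ ≤ C * ‖A‖)
    {A : H →L[ℂ] H} (hA : Continuous fun g => α g A) :
    ∃ T : H →L[ℂ] H, (∀ h, T h = ∫ g, twirl U α φ A g h ∂μ) ∧ ‖T‖ ≤ C * ‖A‖ := by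
  have hint := integrable_twirl μ hU hφ hA
  refine ⟨LinearMap.mkContinuous
    { toFun := fun h => ∫ g, twirl U α φ A g h ∂μ
      map_add' := fun h k => ?_
      map_smul' := fun c h => ?_ } (C * ‖A‖) fun h => ?_, fun h => rfl,
    LinearMap.mkContinuous_norm_le _ (by positivity) _⟩
  · simp only [map_add]
    exact integral_add (hint h) (hint k)
  · simp only [map_smul]
    exact integral_smul c _
  · refine (norm_integral_le_of_norm_le_const (μ := μ)
      (ae_of_all _ fun g => norm_twirl_apply_le hαV hC0 hC A g h)).trans_eq ?_
    simp

/-- The average of a completely positive map over a compact group, as a kernel on operators of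
rank one. -/
theorem exists_averaged_kernel [μ.IsMulRightInvariant]
    (hU : ∀ x : H, Continuous fun g => (U g : H →L[ℂ] H) x)
    (hαV : ∀ g A, α g A = (V g : H →L[ℂ] H) * A * ((V g)⁻¹ : unitary (H →L[ℂ] H)))
    (hα_cont : ∀ (A : H →L[ℂ] H) (x y : H), Continuous fun g => inner ℂ x (α g A y))
    (hφ : IsCP φ) {I : Type*} (b : HilbertBasis I ℂ H) :
    ∃ K : Matrix H H (H →L[ℂ] H), K.PosSemidef ∧
      (∀ x y y', K x (y + y') = K x y + K x y') ∧
      (∀ x (c : ℂ) y, K x (c • y) = star c • K x y) ∧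
      (∃ C : ℝ, (∀ x, ‖K x x‖ ≤ C * ‖x‖ ^ 2) ∧ ∀ F : Finset I, ‖∑ i ∈ F, K (b i) (b i)‖ ≤ C) ∧
      (∀ g x y, K ((V g : H →L[ℂ] H) x) ((V g : H →L[ℂ] H) y) =
        (U g : H →L[ℂ] H) * K x y * ((U g)⁻¹ : unitary (H →L[ℂ] H))) ∧
      ∀ x y h k, ⟪h, K x y k⟫_ℂ = ∫ g, ⟪(U g : H →L[ℂ] H) h,
        φ (α g (rankOne ℂ x y)) ((U g : H →L[ℂ] H) k)⟫_ℂ ∂μ := by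
  have hcont := continuous_action_rankOne hαV hα_cont
  obtain ⟨C, hC0, hC⟩ := hφ.exists_bound
  have hint := fun x y => integrable_twirl (U := U) μ hU hφ.continuous (hcont x y)
  choose K hK hKC using fun x y => exists_average (U := U) μ hU hαV hφ.continuous hC0 hC (hcont x y)
  have hinner : ∀ x y h k, ⟪h, K x y k⟫_ℂ = ∫ g, ⟪(U g : H →L[ℂ] H) h,
      φ (α g (rankOne ℂ x y)) ((U g : H →L[ℂ] H) k)⟫_ℂ ∂μ := fun x y h k => by
    rw [hK, ← integral_inner (hint x y k)]
    simp only [inner_twirl]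
  have hintinner : ∀ x y h k, Integrable (fun g => ⟪(U g : H →L[ℂ] H) h,
      φ (α g (rankOne ℂ x y)) ((U g : H →L[ℂ] H) k)⟫_ℂ) μ := fun x y h k => by
    simpa only [inner_twirl] using (hint x y k).const_inner (𝕜 := ℂ) h
  have hconj : ∀ x y h k, ⟪K x y h, k⟫_ℂ = ∫ g, ⟪(U g : H →L[ℂ] H) h,
      φ (α g (rankOne ℂ y x)) ((U g : H →L[ℂ] H) k)⟫_ℂ ∂μ := fun x y h k => by
    rw [← inner_conj_symm, hinner, ← integral_conj]
    refine integral_congr_ae (ae_of_all _ fun g => ?_)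
    have h1 : α g (star (rankOne ℂ x y)) = star (α g (rankOne ℂ x y)) := (α g).map_star' _
    simp only [inner_conj_symm]
    rw [← star_rankOne x y, h1, hφ.apply_star,
      ← inner_star_left (star (φ (α g (rankOne ℂ x y)))), star_star]
  refine ⟨Matrix.of K, ?_, fun x y y' => ?_, fun x c y => ?_, ⟨C, fun x => ?_, fun F => ?_⟩,
    fun g₀ x y => ?_, hinner⟩
  · have htfae : (Matrix.of K).PosSemidef ↔ (Matrix.of K).IsHermitian ∧ ∀ vv : H →₀ H,
        0 ≤ RCLike.re (vv.sum fun x w => vv.sum fun x' w' => ⟪(Matrix.of K) x' x w, w'⟫_ℂ) :=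
      RKHS.posSemidef_tfae.out 0 2
    refine htfae.2 ⟨?_, fun vv => ?_⟩
    · ext x y k
      refine ext_inner_left ℂ fun h => ?_
      rw [Matrix.conjTranspose_apply, ← inner_star_left, star_star, Matrix.of_apply,
        Matrix.of_apply, hconj, hinner]
    -- Positivity holds for each `g` before integration, since `α g` sends `|x⟩⟨x'|` to `|V g x⟩⟨V g
    -- x'|`.
    · have h1 : ∀ g, 0 ≤ (∑ x ∈ vv.support, ∑ x' ∈ vv.support, ⟪(U g : H →L[ℂ] H) (vv x),
          φ (α g (rankOne ℂ x x')) ((U g : H →L[ℂ] H) (vv x'))⟫_ℂ).re := fun g => by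
        simp only [action_rankOne hαV]
        exact hφ.re_sum_inner_nonneg vv.support (fun x => (V g : H →L[ℂ] H) x)
          fun x => (U g : H →L[ℂ] H) (vv x)
      have h2 : ∑ x ∈ vv.support, ∑ x' ∈ vv.support, ∫ g, ⟪(U g : H →L[ℂ] H) (vv x),
          φ (α g (rankOne ℂ x x')) ((U g : H →L[ℂ] H) (vv x'))⟫_ℂ ∂μ =
          ∫ g, ∑ x ∈ vv.support, ∑ x' ∈ vv.support, ⟪(U g : H →L[ℂ] H) (vv x),
            φ (α g (rankOne ℂ x x')) ((U g : H →L[ℂ] H) (vv x'))⟫_ℂ ∂μ := by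
        rw [integral_finsetSum _ fun x _ => integrable_finsetSum _ fun x' _ => hintinner _ _ _ _]
        exact Finset.sum_congr rfl fun x _ =>
          (integral_finsetSum _ fun x' _ => hintinner _ _ _ _).symm
      simp only [Finsupp.sum, Matrix.of_apply, hconj]
      rw [h2, ← integral_re (integrable_finsetSum _ fun x _ => integrable_finsetSum _ fun x' _ =>
        hintinner _ _ _ _)]
      exact integral_nonneg h1
  · ext k
    simp only [Matrix.of_apply, add_apply, hK]
    rw [← integral_add (hint x y k) (hint x y' k)]
    simp only [twirl, action_rankOne hαV]
    simp only [map_add, opMul_apply, add_apply]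
  · ext k
    simp only [Matrix.of_apply, smul_apply, hK]
    rw [← integral_smul]
    simp only [twirl, action_rankOne hαV]
    simp only [map_smul, map_smulₛₗ, opMul_apply, smul_apply, Complex.star_def]
  · refine (hKC x x).trans_eq ?_
    rw [norm_rankOne, sq]
  -- Adding the bounds for single `i` would grow with `F`. Averaging the projection `∑ |b i⟩⟨b i|`,
  -- of norm at most `1`, as one operator gives `C` for every `F`.
  · have hsum : ∀ g, α g (∑ i ∈ F, rankOne ℂ (b i) (b i)) =
        ∑ i ∈ F, α g (rankOne ℂ (b i) (b i)) := fun g => map_sum (α g) _ _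
    have hF : Continuous fun g => α g (∑ i ∈ F, rankOne ℂ (b i) (b i)) := by
      simp only [hsum]
      exact continuous_finsetSum _ fun i _ => hcont _ _
    obtain ⟨T, hT, hTC⟩ := exists_average (U := U) μ hU hαV hφ.continuous hC0 hC hF
    have h1 : ∑ i ∈ F, K (b i) (b i) = T := by
      ext k
      rw [hT, sum_apply]
      simp only [hK]
      rw [← integral_finsetSum _ fun i _ => hint _ _ k]
      refine integral_congr_ae (ae_of_all _ fun g => ?_)
      simp only [twirl, hsum, map_sum, opMul_apply, sum_apply]
    refine (congrArg norm h1).trans_le (hTC.trans ?_)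
    exact mul_le_of_le_one_right hC0 (norm_sum_rankOne_le b F)
  · ext k
    simp only [Matrix.of_apply, opMul_apply, hK, ← action_rankOne hαV, twirl_action]
    rw [← ContinuousLinearMap.integral_comp_comm _ (hint _ _ _)]
    exact integral_mul_right_eq_self (fun g => (U g₀ : H →L[ℂ] H)
      (twirl U α φ (rankOne ℂ x y) g (((U g₀)⁻¹ : unitary (H →L[ℂ] H)).1 k))) g₀

end Average

end CovDec

namespace CovDec

open Filter Topology MeasureTheory InnerProductSpace

/-! ### Countable index sets -/

section Reindex

variable {H : Type*} [NormedAddCommGroup H] [InnerProductSpace ℂ H]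

theorem HasWeakStarSum.comp_equiv {ι ι' : Type*} {f : ι → (H →L[ℂ] H)} {S : H →L[ℂ] H}
    (hf : HasWeakStarSum f S) (e : ι' ≃ ι) : HasWeakStarSum (fun n => f (e n)) S := by
  have h1 : Tendsto (fun s : Finset ι' => s.map e.toEmbedding) atTop atTop := by
    refine tendsto_atTop_atTop.2 fun t => ⟨t.map e.symm.toEmbedding, fun s hs n hn => ?_⟩
    rw [Finset.mem_map_equiv]
    exact hs (Finset.mem_map_of_mem e.symm.toEmbedding hn)
  refine (Tendsto.comp hf h1).congr fun s => ?_
  simp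

theorem IsUnitaryMatrix.submatrix {ι ι' : Type*} [DecidableEq ι] [DecidableEq ι']
    {N : Matrix ι ι ℂ} (hN : IsUnitaryMatrix N) (e : ι' ≃ ι) :
    IsUnitaryMatrix (N.submatrix e e) where
  rows n k := by
    simpa [Function.comp_def] using e.hasSum_iff.2 (hN.rows (e n) (e k))
  cols n k := by
    simpa [Function.comp_def] using e.hasSum_iff.2 (hN.cols (e n) (e k))

variable [CompleteSpace H]

theorem IsCovariantKraus.reindex {G : Type*} [Group G] {I : Type*} {b : HilbertBasis I ℂ H}
    {U : G →* unitary (H →L[ℂ] H)} {V : G → unitary (H →L[ℂ] H)}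
    {φ : (H →L[ℂ] H) →ₗ[ℂ] (H →L[ℂ] H)} {ι κ ι' κ' : Type*} {X : ι → (H →L[ℂ] H)}
    {W : κ → (H →L[ℂ] H)} (hφ : IsCovariantKraus b U V φ X W) (e : ι' ≃ ι) (f : κ' ≃ κ) :
    IsCovariantKraus b U V φ (fun n => X (e n)) (fun n => W (f n)) where
  summable_X := hφ.summable_X.imp fun _ hS => hS.comp_equiv e
  summable_W := hφ.summable_W.imp fun _ hS => hS.comp_equiv f
  kraus A := by
    obtain ⟨P, Q, hP, hQ, h⟩ := hφ.kraus A
    exact ⟨P, Q, hP.comp_equiv e, hQ.comp_equiv f, h⟩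
  transform_X g := by
    classical
    obtain ⟨N, hN, h⟩ := hφ.transform_X g
    exact ⟨N.submatrix e e, hN.submatrix e, fun n => (h (e n)).comp_equiv e⟩
  transform_W g := by
    classical
    obtain ⟨N, hN, h⟩ := hφ.transform_W g
    exact ⟨N.submatrix f f, hN.submatrix f, fun n => (h (f n)).comp_equiv f⟩

/-- For each `d` in a countable dense set only countably many `n` have `Xₙ* d ≠ 0`; any other `n`
would have `Xₙ* = 0` by density. -/
theorem RowBounded.countable [TopologicalSpace.SeparableSpace H] {ι : Type*}
    {X : ι → (H →L[ℂ] H)} (hX : RowBounded X) (hX0 : ∀ n, X n ≠ 0) : Countable ι := by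
  obtain ⟨D, hD, hDd⟩ := TopologicalSpace.exists_countable_dense H
  have h1 : (⋃ d ∈ D, Function.support fun n => ‖star (X n) d‖ ^ 2).Countable :=
    hD.biUnion fun d _ => (hX.summable d).countable_support
  refine Set.countable_univ_iff.1 (h1.mono fun n _ => ?_)
  by_contra hn
  simp only [Set.mem_iUnion, Function.mem_support, not_exists, not_not] at hn
  refine hX0 n ((star_eq_zero (x := X n)).1 (ContinuousLinearMap.ext fun x => ?_))
  have h2 : Set.EqOn (star (X n) : H →L[ℂ] H) (0 : H →L[ℂ] H) D := fun d hd => by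
    simpa using hn d hd
  exact congrFun (Continuous.ext_on hDd (star (X n)).continuous
    (0 : H →L[ℂ] H).continuous h2) x

end Reindex

/-! ### Covariant maps have covariant Kraus families -/

section Approximation

variable {H : Type*} [NormedAddCommGroup H] [InnerProductSpace ℂ H]
  {I : Type*} (b : HilbertBasis I ℂ H)

theorem mul_sum_rankOne (A : H →L[ℂ] H) (F : Finset I) :
    A * ∑ i ∈ F, rankOne ℂ (b i) (b i) = ∑ i ∈ F, rankOne ℂ (A (b i)) (b i) := by
  rw [Finset.mul_sum]
  exact Finset.sum_congr rfl fun i _ => comp_rankOne _ _ _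

/-- Dominated convergence: the truncations `A P_F` tend strongly to `A`, and `‖P_F‖ ≤ 1`. The
statement serves both the weak-* functionals and the Kraus sums. -/
theorem tendsto_tsum_inner_rankOne {ι : Type*} {a c : ι → H}
    (ha : Summable fun n => ‖a n‖ ^ 2) (hc : Summable fun n => ‖c n‖ ^ 2) (A : H →L[ℂ] H) :
    Tendsto (fun F : Finset I => ∑' n, ⟪a n, (∑ i ∈ F, rankOne ℂ (A (b i)) (b i)) (c n)⟫_ℂ) atTop
      (𝓝 (∑' n, ⟪a n, A (c n)⟫_ℂ)) := by
  simp only [← mul_sum_rankOne, opMul_apply]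
  refine tendsto_tsum_of_dominated_convergence ((ha.add hc).mul_left ‖A‖) (fun n => ?_)
    (Eventually.of_forall fun F n => ?_)
  · have h1 : Tendsto (fun F : Finset I => (∑ i ∈ F, rankOne ℂ (b i) (b i)) (c n)) atTop
        (𝓝 (c n)) := by
      refine Tendsto.congr (fun F => ?_) (b.hasSum_repr (c n))
      simp [sum_apply, b.repr_apply_apply]
    exact ((innerSL ℂ (a n)).continuous.tendsto _).comp ((A.continuous.tendsto _).comp h1)
  · have h1 : ‖(∑ i ∈ F, rankOne ℂ (b i) (b i)) (c n)‖ ≤ ‖c n‖ := by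
      simpa using ContinuousLinearMap.le_of_opNorm_le _ (norm_sum_rankOne_le b F) (c n)
    calc ‖⟪a n, A ((∑ i ∈ F, rankOne ℂ (b i) (b i)) (c n))⟫_ℂ‖
        ≤ ‖a n‖ * (‖A‖ * ‖c n‖) := (norm_inner_le_norm _ _).trans
          (mul_le_mul_of_nonneg_left ((A.le_opNorm _).trans
            (mul_le_mul_of_nonneg_left h1 (norm_nonneg _))) (norm_nonneg _))
      _ = ‖A‖ * (‖a n‖ * ‖c n‖) := by ring
      _ ≤ ‖A‖ * (‖a n‖ ^ 2 + ‖c n‖ ^ 2) := by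
          refine mul_le_mul_of_nonneg_left ?_ (norm_nonneg _)
          nlinarith [sq_nonneg (‖a n‖ - ‖c n‖), sq_nonneg ‖a n‖, sq_nonneg ‖c n‖]

theorem tendsto_weakStar_rankOne (A : H →L[ℂ] H) :
    Tendsto (fun F : Finset I => ∑ i ∈ F, rankOne ℂ (A (b i)) (b i)) atTop
      (@nhds _ (weakStarTopology H) A) :=
  tendsto_weakStar_iff.2 fun x y =>
    tendsto_tsum_inner_rankOne b (summable_lp_sq x) (summable_lp_sq y) A

end Approximation

section Main

variable {G : Type*} [Group G] [TopologicalSpace G] [IsTopologicalGroup G] [CompactSpace G]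

theorem exists_isMulRightInvariant_isProbabilityMeasure [MeasurableSpace G] [BorelSpace G] :
    ∃ μ : Measure G, μ.IsMulRightInvariant ∧ IsProbabilityMeasure μ := by
  -- Inversion turns the left-invariant Haar measure, normalised on the whole group, into a
  -- right-invariant one.
  refine ⟨(Measure.haarMeasure (⊤ : TopologicalSpace.PositiveCompacts G)).inv, inferInstance,
    ⟨?_⟩⟩
  rw [Measure.inv_apply, Set.inv_univ]
  exact Measure.haarMeasure_self

open scoped Classical in
/-- The average of a completely positive map over a compact group has a covariant Kraus family. -/
theorem exists_kraus_average [MeasurableSpace G] [BorelSpace G] (μ : Measure G)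
    [μ.IsMulRightInvariant] [IsProbabilityMeasure μ]
    {H : Type u} [NormedAddCommGroup H] [InnerProductSpace ℂ H] [CompleteSpace H]
    {U : G →* unitary (H →L[ℂ] H)} {V : G → unitary (H →L[ℂ] H)}
    {α : G →* ((H →L[ℂ] H) ≃⋆ₐ[ℂ] (H →L[ℂ] H))} {φ : (H →L[ℂ] H) →ₗ[ℂ] (H →L[ℂ] H)}
    (hU : ∀ x : H, Continuous fun g => (U g : H →L[ℂ] H) x)
    (hαV : ∀ g A, α g A = (V g : H →L[ℂ] H) * A * ((V g)⁻¹ : unitary (H →L[ℂ] H)))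
    (hα_cont : ∀ (A : H →L[ℂ] H) (x y : H), Continuous fun g => inner ℂ x (α g A y))
    (hφ : IsCP φ) {I : Type*} (b : HilbertBasis I ℂ H) :
    ∃ (ι : Type u) (X : ι → (H →L[ℂ] H)), RowBounded X ∧ (∀ n, X n ≠ 0) ∧
      (∀ x y h k, Integrable (fun g => ⟪(U g : H →L[ℂ] H) h,
        φ (α g (rankOne ℂ x y)) ((U g : H →L[ℂ] H) k)⟫_ℂ) μ ∧
        HasSum (fun n => ⟪star (X n) h, rankOne ℂ x y (star (X n) k)⟫_ℂ)
          (∫ g, ⟪(U g : H →L[ℂ] H) h, φ (α g (rankOne ℂ x y)) ((U g : H →L[ℂ] H) k)⟫_ℂ ∂μ)) ∧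
      ∀ g, ∃ N : Matrix ι ι ℂ, IsUnitaryMatrix N ∧ ∀ n, HasWeakStarSum (fun m => N n m • X m)
        ((U g : H →L[ℂ] H) * X n * ((V g)⁻¹ : unitary (H →L[ℂ] H))) := by
  obtain ⟨K, hK, hadd, hsmul, ⟨C, hC, hrow⟩, hcov, hinner⟩ :=
    exists_averaged_kernel μ hU hαV hα_cont hφ b
  obtain ⟨ι, X, hX, hX0, hXK, hXN⟩ := exists_kraus_of_kernel b K hK hadd hsmul hC hrow
  refine ⟨ι, X, hX, hX0, fun x y h k => ⟨?_, ?_⟩, fun g => hXN (U g) (V g) (hcov g)⟩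
  · simpa only [inner_twirl] using (integrable_twirl (U := U) μ hU hφ.continuous
      (continuous_action_rankOne hαV hα_cont x y) k).const_inner (𝕜 := ℂ) h
  · rw [← hinner]
    refine (hXK x y h k).congr_fun fun n => ?_
    rw [rankOne_apply, inner_smul_right, inner_star_left, ← inner_star_left (star (X n)), star_star,
      mul_comm]

/-- A normal covariant decomposable map has a covariant Kraus representation. -/
theorem IsCovariant.exists_isCovariantKraus
    {H : Type u} [NormedAddCommGroup H] [InnerProductSpace ℂ H] [CompleteSpace H]
    {I : Type*} (b : HilbertBasis I ℂ H)
    {U : G →* unitary (H →L[ℂ] H)} {V : G → unitary (H →L[ℂ] H)}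
    {α : G →* ((H →L[ℂ] H) ≃⋆ₐ[ℂ] (H →L[ℂ] H))} {φ : (H →L[ℂ] H) →ₗ[ℂ] (H →L[ℂ] H)}
    (hU : ∀ x : H, Continuous fun g => (U g : H →L[ℂ] H) x)
    (hαV : ∀ g A, α g A = (V g : H →L[ℂ] H) * A * ((V g)⁻¹ : unitary (H →L[ℂ] H)))
    (hα_cont : ∀ (A : H →L[ℂ] H) (x y : H), Continuous fun g => inner ℂ x (α g A y))
    (hφ : IsDecomposable b φ) (hφ_normal : IsNormal φ) (hcov : IsCovariant α U φ) :
    ∃ (ι κ : Type u) (X : ι → (H →L[ℂ] H)) (W : κ → (H →L[ℂ] H)),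
      RowBounded X ∧ RowBounded W ∧ (∀ n, X n ≠ 0) ∧ (∀ n, W n ≠ 0) ∧
        IsCovariantKraus b U V φ X W := by
  let _ : MeasurableSpace G := borel G
  have : BorelSpace G := ⟨rfl⟩
  obtain ⟨μ, _, _⟩ := exists_isMulRightInvariant_isProbabilityMeasure (G := G)
  obtain ⟨φ₁, φ₂, h₁, h₂, hφ₁₂⟩ := hφ
  obtain ⟨ι, X, hX, hX0, hXφ, hXN⟩ := exists_kraus_average μ hU hαV hα_cont h₁ b
  obtain ⟨κ, W, hW, hW0, hWφ, hWN⟩ := exists_kraus_average μ (continuous_conjRep b U hU) hαV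
    hα_cont h₂ b
  have hrank : ∀ x y h k, ⟪h, φ (rankOne ℂ x y) k⟫_ℂ =
      ∑' n, ⟪star (X n) h, rankOne ℂ x y (star (X n) k)⟫_ℂ +
        ∑' n, ⟪star (W n) (J b k), rankOne ℂ x y (star (W n) (J b h))⟫_ℂ := by
    intro x y h k
    rw [(hXφ x y h k).2.tsum_eq, (hWφ x y (J b k) (J b h)).2.tsum_eq,
      ← integral_add (hXφ x y h k).1 (hWφ x y (J b k) (J b h)).1]
    -- Neither average equals its original summand, but by covariance of `φ` the two integrands add
    -- up to a constant in `g`.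
    have hconst : ∀ g, ⟪(U g : H →L[ℂ] H) h, φ₁ (α g (rankOne ℂ x y)) ((U g : H →L[ℂ] H) k)⟫_ℂ +
        ⟪(conjRep b U g : H →L[ℂ] H) (J b k), (transpose b ∘ₗ φ₂) (α g (rankOne ℂ x y))
          ((conjRep b U g : H →L[ℂ] H) (J b h))⟫_ℂ = ⟪h, φ (rankOne ℂ x y) k⟫_ℂ := fun g => by
      rw [conjRep_apply, conjRep_apply, J_J, J_J, LinearMap.comp_apply, ← inner_transpose,
        transpose_transpose, ← inner_add_right, ← add_apply, ← LinearMap.add_apply, ← hφ₁₂, hcov,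
        opMul_apply, opMul_apply, ← opMul_apply _ (U g : H →L[ℂ] H), coe_inv_unitary,
        Unitary.coe_star_mul_self, ← inner_star_left, ← opMul_apply, Unitary.coe_star_mul_self]
      rfl
    simp only [hconst]
    simp
  have hsumm : ∀ (F : Finset I) (A : H →L[ℂ] H) (h k : H),
      ⟪h, φ (∑ i ∈ F, rankOne ℂ (A (b i)) (b i)) k⟫_ℂ =
      ∑' n, ⟪star (X n) h, (∑ i ∈ F, rankOne ℂ (A (b i)) (b i)) (star (X n) k)⟫_ℂ +
        ∑' n, ⟪star (W n) (J b k), (∑ i ∈ F, rankOne ℂ (A (b i)) (b i))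
          (star (W n) (J b h))⟫_ℂ := by
    intro F A h k
    simp only [map_sum, sum_apply, inner_sum, hrank]
    rw [Summable.tsum_finsetSum fun i _ => (hXφ _ _ h k).2.summable,
      Summable.tsum_finsetSum fun i _ => (hWφ _ _ (J b k) (J b h)).2.summable,
      Finset.sum_add_distrib]
  have hkraus : ∀ A h k, ⟪h, φ A k⟫_ℂ = ∑' n, ⟪star (X n) h, A (star (X n) k)⟫_ℂ +
      ∑' n, ⟪star (W n) (J b k), A (star (W n) (J b h))⟫_ℂ := by
    intro A h k
    -- The only use of normality: both sides of the Kraus formula are limits along the finite-rank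
    -- truncations of `A`, where they already agree.
    have h1 := tendsto_inner_of_weakStar (Tendsto.comp (@Continuous.tendsto _ _
      (weakStarTopology H) (weakStarTopology H) φ hφ_normal A) (tendsto_weakStar_rankOne b A)) h k
    have h2 := (tendsto_tsum_inner_rankOne b (hX.summable h) (hX.summable k) A).add
      (tendsto_tsum_inner_rankOne b (hW.summable (J b k)) (hW.summable (J b h)) A)
    refine tendsto_nhds_unique h1 (h2.congr fun F => ?_)
    rw [Function.comp_apply, hsumm]
  refine ⟨ι, κ, X, W, hX, hW, hX0, hW0, ?_, ?_, fun A => ?_, hXN, hWN⟩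
  · simpa only [mul_one] using hX.exists_hasWeakStarSum 1
  · simpa only [mul_one] using hW.exists_hasWeakStarSum 1
  · obtain ⟨P, hP⟩ := hX.exists_hasWeakStarSum A
    obtain ⟨Q, hQ⟩ := (hW.conjOp b).exists_hasWeakStarSum (transpose b A)
    refine ⟨P, Q, hP, hQ, ContinuousLinearMap.ext fun k => ext_inner_left ℂ fun h => ?_⟩
    rw [hkraus, add_apply, inner_add_right, ← (hP.hasSum_inner h k).tsum_eq,
      ← (hQ.hasSum_inner h k).tsum_eq]
    exact congrArg₂ _ (tsum_congr fun n => (inner_mul_mul_star _ _ _ _).symm)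
      (tsum_congr fun n => (inner_conjOp_kraus b _ _ _ _).symm)

end Main

end CovDec

end

/-! ### The main theorem -/

theorem mainTheorem11
    {G : Type*} [Group G] [TopologicalSpace G] [IsTopologicalGroup G] [CompactSpace G]
    {H : Type u} [NormedAddCommGroup H] [InnerProductSpace ℂ H] [CompleteSpace H]
    {I : Type*} (b : HilbertBasis I ℂ H)
    (U : G →* unitary (H →L[ℂ] H))
    (hU : ∀ x : H, Continuous fun g => (U g : H →L[ℂ] H) x)
    (V : G → unitary (H →L[ℂ] H))
    (α : G →* ((H →L[ℂ] H) ≃⋆ₐ[ℂ] (H →L[ℂ] H)))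
    (hαV : ∀ g A, α g A = (V g : H →L[ℂ] H) * A * ((V g)⁻¹ : unitary (H →L[ℂ] H)))
    (hα_cont : ∀ (A : H →L[ℂ] H) (x y : H), Continuous fun g => inner ℂ x (α g A y))
    (φ : (H →L[ℂ] H) →ₗ[ℂ] (H →L[ℂ] H))
    (hφ : CovDec.IsDecomposable b φ) (hφ_normal : CovDec.IsNormal φ) :
    (CovDec.IsCovariant α U φ ↔
      ∃ (ι κ : Type u) (X : ι → (H →L[ℂ] H)) (W : κ → (H →L[ℂ] H)),
        CovDec.IsCovariantKraus b U V φ X W) ∧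
    (TopologicalSpace.SeparableSpace H →
      (CovDec.IsCovariant α U φ ↔
        ∃ (ι κ : Type) (_ : Countable ι) (_ : Countable κ)
          (X : ι → (H →L[ℂ] H)) (W : κ → (H →L[ℂ] H)),
          CovDec.IsCovariantKraus b U V φ X W)) := by
  refine ⟨⟨fun hcov => ?_, ?_⟩, fun hsep => ⟨fun hcov => ?_, ?_⟩⟩
  · obtain ⟨ι, κ, X, W, -, -, -, -, h⟩ :=
      hcov.exists_isCovariantKraus b hU hαV hα_cont hφ hφ_normal
    exact ⟨ι, κ, X, W, h⟩
  · rintro ⟨ι, κ, X, W, h⟩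
    exact h.isCovariant hαV
  · obtain ⟨ι, κ, X, W, hX, hW, hX0, hW0, h⟩ :=
      hcov.exists_isCovariantKraus b hU hαV hα_cont hφ hφ_normal
    have hι : Countable ι := hX.countable hX0
    have hκ : Countable κ := hW.countable hW0
    -- Countable types are small, so the families can be reindexed by types in the lowest universe.
    let e := equivShrink.{0} ι
    let f := equivShrink.{0} κ
    exact ⟨_, _, e.symm.injective.countable, f.symm.injective.countable, _, _,
      h.reindex e.symm f.symm⟩
  · rintro ⟨ι, κ, -, -, X, W, h⟩
    exact h.isCovariant hαV
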